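/- Let $n\ge m$ and let norms $\|\cdot\|$ on $\mathbb{R}^n,\mathbb{R}^m,\mathbb{R}^{n-m}$ be fixed. Consider the control system $$\dot x(t)=f(x(t))+g(x(t))u(t),\quad x(t^0)=x^0,\qquad y(t)=h(x(t)),$$ with $f\in C^1(\mathbb{R}^n,\mathbb{R}^n)$, $g\in C^1(\mathbb{R}^n,\mathbb{R}^{n\times m})$, $h\in C^2(\mathbb{R}^n,\mathbb{R}^m)$, belonging to the system class $\mathcal{N}^m$, that is: (a) the matrix $\Gamma(x):=h'(x)g(x)$ is invertible for every $x\in\mathbb{R}^n$; (b) the distribution $x\mapsto\operatorname{im}g(x)$ is involutive: for all smooth vector fields $\psi_1,\psi_2$ on $\mathbb{R}^n$ with values in this distribution, the Lie bracket $[\psi_1,\psi_2]$ has values in it as well; (c) there is a diffeomorphism $\Phi:\mathbb{R}^n\to\mathbb{R}^m\times\mathbb{R}^{n-m}$, $\Phi(x)=(y,\eta)$ with $y=h(x)$, which puts the system into Byrnes–Isidori form $$\dot y=p(y,\eta)+\Gamma(\Phi^{-1}(y,\eta))u,\qquad \dot\eta=q(y,\eta),$$ with $p,q$ of class $C^1$,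 such that the bounded-input, bounded-state condition holds: for every $c_0>0$ there is $c_1>0$ such that for all $t^0\ge0$, $\eta^0\in\mathbb{R}^{n-m}$ and $y\in L^\infty_{\rm loc}([t^0,\infty),\mathbb{R}^m)$ with $\|\eta^0\|+\|y\|_\infty\le c_0$ the maximal solution $\eta$ of $\dot\eta=q(y,\eta)$, $\eta(t^0)=\eta^0$, satisfies $\|\eta\|_\infty\le c_1$. Solutions are understood in the sense of Carathéodory (absolutely continuous, satisfying the equation almost everywhere). Elements of $W^{1,\infty}(\mathbb{R}_{\ge0})$ (essentially bounded functions with an essentially bounded weak derivative) are identified with their continuous representatives. Let $\varphi\in W^{1,\infty}(\mathbb{R}_{\ge0},\mathbb{R})$ with $\inf_{t\ge0}\varphi(t)>0$, $y_{\rm ref}\in W^{1,\infty}(\mathbb{R}_{\ge0},\mathbb{R}^m)$, $\lambda_u\ge0$, $T>0$, $M>0$, $t^0\ge0$, and let $x^0\in\mathcal{D}^\varphi_{t^0}$, where $$\mathcal{D}^\varphi_t:=\{x\in\mathbb{R}^n:\varphi(t)\|h(x)-y_{\rm ref}(t)\|<1\}.$$ Let $\mathcal{U}_T(t^0,x^0)$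 be the set of all $u\in L^\infty([t^0,t^0+T],\mathbb{R}^m)$ whose response $x(\cdot;t^0,x^0,u)$ exists on the whole of $[t^0,t^0+T]$, and let $$\mathcal{U}^\varphi_T(M,t^0,x^0):=\{u\in\mathcal{U}_T(t^0,x^0): \|u\|_\infty\le M,\ x(t;t^0,x^0,u)\in\mathcal{D}^\varphi_t\ \text{for all } t\in[t^0,t^0+T]\}.$$ Define the stage cost $$\ell_\varphi(t,x,u):=\begin{cases}\dfrac{1}{1-\varphi(t)^2\|h(x)-y_{\rm ref}(t)\|^2}-1+\lambda_u\|u\|^2,&\varphi(t)\|h(x)-y_{\rm ref}(t)\|\ne1,\\ \infty,&\text{otherwise,}\end{cases}$$ and, for $u\in L^\infty([t^0,t^0+T],\mathbb{R}^m)$, the cost functional $$J^\varphi_T(u;t^0,x^0):=\int_{t^0}^{t^0+T}\ell_\varphi(t,x(t;t^0,x^0,u),u(t))\,dt$$ if $u\in\mathcal{U}_T(t^0,x^0)$ and the integrand is quasi-integrable (it is measurable and its positive part or its negative part has a finite integral), and $J^\varphi_T(u;t^0,x^0):=\infty$ otherwise. Suppose that $\mathcal{U}^\varphi_T(M,t^0,x^0)\neq\emptyset$.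 Then there exists $\bar u\in\mathcal{U}^\varphi_T(M,t^0,x^0)$ such that $$J^\varphi_T(\bar u;t^0,x^0)=\min_{u\in\mathcal{U}^\varphi_T(M,t^0,x^0)}J^\varphi_T(u;t^0,x^0)=\min_{\substack{u\in L^\infty([t^0,t^0+T],\mathbb{R}^m)\\ \|u\|_\infty\le M}}J^\varphi_T(u;t^0,x^0).$$ -/

import Mathlib

open MeasureTheory Set
open scoped ENNReal ContDiff

namespace FunnelMPC

section Sobolev

variable {E : Type*} [NormedAddCommGroup E] [NormedSpace ℝ E]

/-- `v` is the weak derivative of `f` on the half line `[0, ∞)`: integration by parts holds against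
all smooth test functions whose compact support lies in `(0, ∞)`. -/
def IsWeakDerivOnHalfLine (f v : ℝ → E) : Prop :=
  ∀ ψ : ℝ → ℝ, ContDiff ℝ ∞ ψ → HasCompactSupport ψ → tsupport ψ ⊆ Ioi 0 →
    ∫ t in Ici (0 : ℝ), deriv ψ t • f t = - ∫ t in Ici (0 : ℝ), ψ t • v t

/-- `f ∈ W^{1,∞}(ℝ≥0, E)`: `f` is essentially bounded on `[0, ∞)` and has an essentially bounded
weak derivative there. Elements of this space are evaluated pointwise, so `f` is required to be the
continuous representative of its class. Only the values of `f` on `[0, ∞)` matter. -/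
structure MemW1Infty (f : ℝ → E) : Prop where
  continuousOn : ContinuousOn f (Ici 0)
  memLp : MemLp f ∞ (volume.restrict (Ici 0))
  exists_weakDeriv : ∃ v : ℝ → E, MemLp v ∞ (volume.restrict (Ici 0)) ∧ IsWeakDerivOnHalfLine f v

end Sobolev

/-- The set `𝒢` of funnel functions: `φ ∈ W^{1,∞}(ℝ≥0, ℝ)` with `inf_{t ≥ 0} φ t > 0`. (The real
infimum of a set that is not bounded below is `0`, so positivity includes boundedness below.) -/
def funnelFunctions : Set (ℝ → ℝ) :=
  {φ | MemW1Infty φ ∧ 0 < sInf (φ '' Ici 0)}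

/-- `z` is a Carathéodory solution on the compact interval `[t₀, t₁]` of
`z'(t) = F t (z t)`, `z t₀ = z₀`: it is absolutely continuous and satisfies the
differential equation almost everywhere. -/
structure IsCaratheodorySolution {E : Type*} [NormedAddCommGroup E] [NormedSpace ℝ E]
    (F : ℝ → E → E) (t₀ t₁ : ℝ) (z₀ : E) (z : ℝ → E) : Prop where
  absolutelyContinuous : AbsolutelyContinuousOnInterval z t₀ t₁
  initial : z t₀ = z₀
  ae_hasDerivAt : ∀ᵐ t ∂(volume.restrict (Icc t₀ t₁)), HasDerivAt z (F t (z t)) t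

/-- A control affine system `x' = f x + g x u`, `y = h x` with `f, g` of class `C¹` and `h` of class
`C²`. The finite-dimensional normed space `X` is the state space (`ℝⁿ`), the finite-dimensional
normed space `Y` is the common space of inputs and outputs (`ℝᵐ` with an arbitrary norm). -/
structure ControlSystem (X Y : Type*) [NormedAddCommGroup X] [NormedSpace ℝ X]
    [NormedAddCommGroup Y] [NormedSpace ℝ Y] where
  f : X → X
  g : X → (Y →L[ℝ] X)
  h : X → Y
  contDiff_f : ContDiff ℝ 1 f
  contDiff_g : ContDiff ℝ 1 g
  contDiff_h : ContDiff ℝ 2 h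

namespace ControlSystem

variable {X Y : Type*} [NormedAddCommGroup X] [NormedSpace ℝ X]
  [NormedAddCommGroup Y] [NormedSpace ℝ Y]

/-! ### The system class -/

/-- The high-frequency gain matrix `Γ x = h'(x) g(x)`. -/
noncomputable def highFreqGain (S : ControlSystem X Y) (x : X) : Y →L[ℝ] Y :=
  (fderiv ℝ S.h x).comp (S.g x)

/-- Global relative degree one: `Γ x` is invertible for every `x`. -/
def HasRelativeDegreeOne (S : ControlSystem X Y) : Prop :=
  ∀ x, IsUnit (S.highFreqGain x)

/-- The distribution `x ↦ im (g x)` is involutive: the Lie bracket of smooth vector fields with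
values in the distribution has values in the distribution. -/
def IsInvolutive (S : ControlSystem X Y) : Prop :=
  ∀ ψ₁ ψ₂ : X → X, ContDiff ℝ ∞ ψ₁ → ContDiff ℝ ∞ ψ₂ →
    (∀ x, ψ₁ x ∈ range (S.g x)) → (∀ x, ψ₂ x ∈ range (S.g x)) →
      ∀ x, VectorField.lieBracket ℝ ψ₁ ψ₂ x ∈ range (S.g x)

/-- The space `ℝ^{n-m}` of the internal states `η`, where `n = dim X` and `m = dim Y`. -/
abbrev InternalSpace (X Y : Type*) [NormedAddCommGroup X] [NormedSpace ℝ X]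
    [NormedAddCommGroup Y] [NormedSpace ℝ Y] : Type :=
  EuclideanSpace ℝ (Fin (Module.finrank ℝ X - Module.finrank ℝ Y))

/-- The diffeomorphism `Φ : X → Y × ℝ^{n-m}`, `(y, η) = Φ x` with `y = h x`, puts the system into
Byrnes-Isidori form `y' = p (y, η) + Γ (Φ⁻¹ (y, η)) u`, `η' = q (y, η)`. -/
structure IsByrnesIsidoriForm (S : ControlSystem X Y) (Φ : X ≃ Y × InternalSpace X Y)
    (p : Y × InternalSpace X Y → Y)
    (q : Y × InternalSpace X Y → InternalSpace X Y) : Prop where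
  contDiff_toFun : ContDiff ℝ 1 Φ
  contDiff_symm : ContDiff ℝ 1 Φ.symm
  contDiff_p : ContDiff ℝ 1 p
  contDiff_q : ContDiff ℝ 1 q
  output : ∀ x, (Φ x).1 = S.h x
  transform : ∀ (z : Y × InternalSpace X Y) (u : Y),
    fderiv ℝ Φ (Φ.symm z) (S.f (Φ.symm z) + S.g (Φ.symm z) u) =
      (p z + S.highFreqGain (Φ.symm z) u, q z)

/-- The bounded-input, bounded-state condition for the internal dynamics `η' = q (y, η)`: for all
`c₀ > 0` there is `c₁ > 0` such that `‖η₀‖ + ‖y‖_∞ ≤ c₀` implies `‖η(·; t₀, η₀, y)‖_∞ ≤ c₁`. The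
maximal solution `η(·; t₀, η₀, y)` enters through all its restrictions to compact intervals
`[t₀, t₁]`; a bound on all of them forces the maximal solution to be global. -/
def IsBIBS (q : Y × InternalSpace X Y → InternalSpace X Y) : Prop :=
  ∀ c₀ > (0 : ℝ), ∃ c₁ > (0 : ℝ), ∀ t₀ ≥ (0 : ℝ), ∀ (η₀ : InternalSpace X Y) (y : ℝ → Y),
    AEStronglyMeasurable y (volume.restrict (Ici t₀)) →
    ‖η₀‖ₑ + eLpNorm y ∞ (volume.restrict (Ici t₀)) ≤ ENNReal.ofReal c₀ →
    ∀ t₁ ≥ t₀, ∀ η : ℝ → InternalSpace X Y,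
      IsCaratheodorySolution (fun t z => q (y t, z)) t₀ t₁ η₀ η →
        ∀ t ∈ Icc t₀ t₁, ‖η t‖ ≤ c₁

/-- The system class `𝒩ᵐ`: global relative degree one, involutive distribution `x ↦ im (g x)`, and
a Byrnes-Isidori form whose internal dynamics satisfy the BIBS condition. -/
structure InSystemClass (S : ControlSystem X Y) : Prop where
  relativeDegreeOne : S.HasRelativeDegreeOne
  involutive : S.IsInvolutive
  bibs : ∃ Φ p q, S.IsByrnesIsidoriForm Φ p q ∧ IsBIBS q

/-! ### Responses, the funnel, and the cost functional -/

/-- The space `L^∞([t₀, t₀ + T], Y)` of controls. -/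
abbrev Control (Y : Type*) [NormedAddCommGroup Y] (T t₀ : ℝ) : Type _ :=
  Lp Y ∞ ((volume : Measure ℝ).restrict (Icc t₀ (t₀ + T)))

/-- `x` is a solution on `[t₀, t₀ + T]` of the initial value problem `x' = f x + g x u`,
`x t₀ = x₀`. -/
def IsResponse (S : ControlSystem X Y) (T t₀ : ℝ) (x₀ : X) (u : Control Y T t₀)
    (x : ℝ → X) : Prop :=
  IsCaratheodorySolution (fun t z => S.f z + S.g z (u t)) t₀ (t₀ + T) x₀ x

/-- The set `𝒰_T(t₀, x₀)` of controls whose response exists on the whole of `[t₀, t₀ + T]`. -/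
def feasibleControls (S : ControlSystem X Y) (T t₀ : ℝ) (x₀ : X) : Set (Control Y T t₀) :=
  {u | ∃ x, S.IsResponse T t₀ x₀ u x}

open Classical in
/-- The response `x(·; t₀, x₀, u)` on `[t₀, t₀ + T]`, for `u ∈ 𝒰_T(t₀, x₀)` (it is unique because
`f` and `g` are locally Lipschitz). It is never used for other controls. -/
noncomputable def response (S : ControlSystem X Y) (T t₀ : ℝ) (x₀ : X) (u : Control Y T t₀) :
    ℝ → X :=
  if hu : ∃ x, S.IsResponse T t₀ x₀ u x then hu.choose else fun _ => x₀

/-- The set `𝒟^φ_t` of states whose output lies in the funnel at time `t`. -/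
def funnelStates (S : ControlSystem X Y) (φ : ℝ → ℝ) (yref : ℝ → Y) (t : ℝ) : Set X :=
  {x | φ t * ‖S.h x - yref t‖ < 1}

/-- The set `𝒰^φ_T(M, t₀, x₀)` of controls bounded by `M` whose response exists on `[t₀, t₀ + T]`
and has its output in the funnel on this interval. -/
def admissibleControls (S : ControlSystem X Y) (φ : ℝ → ℝ) (yref : ℝ → Y) (T M t₀ : ℝ) (x₀ : X) :
    Set (Control Y T t₀) :=
  {u | u ∈ S.feasibleControls T t₀ x₀ ∧
    (∀ t ∈ Icc t₀ (t₀ + T), S.response T t₀ x₀ u t ∈ S.funnelStates φ yref t) ∧ ‖u‖ ≤ M}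

open Classical in
/-- The stage cost `ℓ_φ`, with values in `ℝ ∪ {∞}`. -/
noncomputable def stageCost (S : ControlSystem X Y) (φ : ℝ → ℝ) (yref : ℝ → Y) (lam : ℝ)
    (t : ℝ) (x : X) (u : Y) : EReal :=
  if φ t * ‖S.h x - yref t‖ ≠ 1 then
    ((1 / (1 - φ t ^ 2 * ‖S.h x - yref t‖ ^ 2) - 1 + lam * ‖u‖ ^ 2 : ℝ) : EReal)
  else ⊤

end ControlSystem

/-- `ζ` is quasi-integrable: it is measurable and at least one of the integrals of its positive and
its negative part is finite. -/
def QuasiIntegrable (ζ : ℝ → EReal) (μ : Measure ℝ) : Prop :=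
  AEMeasurable ζ μ ∧ (∫⁻ t, (ζ t).toENNReal ∂μ < ⊤ ∨ ∫⁻ t, (-ζ t).toENNReal ∂μ < ⊤)

/-- The Lebesgue integral of an extended real function: the integral of the positive part minus the
integral of the negative part. It is only used for quasi-integrable functions. -/
noncomputable def extendedIntegral (ζ : ℝ → EReal) (μ : Measure ℝ) : EReal :=
  ((∫⁻ t, (ζ t).toENNReal ∂μ : ℝ≥0∞) : EReal) - ((∫⁻ t, (-ζ t).toENNReal ∂μ : ℝ≥0∞) : EReal)

namespace ControlSystem

variable {X Y : Type*} [NormedAddCommGroup X] [NormedSpace ℝ X]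
  [NormedAddCommGroup Y] [NormedSpace ℝ Y]

/-- The stage cost along the response to the control `u`. -/
noncomputable def stageCostAlong (S : ControlSystem X Y) (φ : ℝ → ℝ) (yref : ℝ → Y) (lam : ℝ)
    (T t₀ : ℝ) (x₀ : X) (u : Control Y T t₀) (t : ℝ) : EReal :=
  S.stageCost φ yref lam t (S.response T t₀ x₀ u t) (u t)

open Classical in
/-- The cost functional `J^φ_T(·; t₀, x₀)`. -/
noncomputable def cost (S : ControlSystem X Y) (φ : ℝ → ℝ) (yref : ℝ → Y) (lam : ℝ)
    (T t₀ : ℝ) (x₀ : X) (u : Control Y T t₀) : EReal :=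
  if u ∈ S.feasibleControls T t₀ x₀ ∧
      QuasiIntegrable (S.stageCostAlong φ yref lam T t₀ x₀ u)
        (volume.restrict (Icc t₀ (t₀ + T))) then
    extendedIntegral (S.stageCostAlong φ yref lam T t₀ x₀ u) (volume.restrict (Icc t₀ (t₀ + T)))
  else ⊤

end ControlSystem

end FunnelMPC

namespace FunnelMPC

open Filter Topology NNReal

/-! ### Absolutely continuous curves and the mean value inequality -/

section AbsoluteContinuity

/-! The direct method. For admissible controls the outputs are uniformly bounded, so the BIBS
condition bounds the internal states and all responses stay in one ball (`exists_response_bound`).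
With `‖u‖ ≤ M` they are equi-Lipschitz. Along a minimizing sequence, Arzelà-Ascoli is applied to the
triples of the response, the primitive `U` of the control and the primitive `c` of its squared norm
(`exists_subseq_tendsto_response`). The limit of the primitives is Lipschitz, and its a.e.
derivative is the limit control; this replaces weak-star compactness. As the control enters
affinely, the first order expansion of a response involves it only through `U` and passes to the
limit. So does the Cauchy-Schwarz inequality `‖U t - U s‖² ≤ (t - s) (c t - c s)`, which gives lower
semicontinuity of the control energy. Fatou's lemma handles the barrier term.

The funnel constraint is open, so a limit could touch its boundary. But the tracking error `w` is
Lipschitz: if it first reaches `1` at time `c`, then `1 - w² ≤ 2K(c - t)` before `c`, and the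
barrier dominates a multiple of `1/(c - t)`, up to a constant, hence is not integrable
(`exists_lintegral_barrier_eq_top`). This keeps a limit of finite cost strictly inside the funnel.
It also gives cost `⊤` to every control with `‖u‖ ≤ M` that is not admissible (`cost_eq_top`), so
both minima agree. -/

theorem absolutelyContinuousOnInterval_lipschitzOnWith_comp {E F : Type*} [PseudoMetricSpace E]
    [PseudoMetricSpace F] {f : ℝ → E} {g : E → F} {a b : ℝ} {s : Set E} {K : ℝ≥0} (hg : LipschitzOnWith K g s)
    (hf : AbsolutelyContinuousOnInterval f a b) (hs : MapsTo f (uIcc a b) s) :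
    AbsolutelyContinuousOnInterval (g ∘ f) a b := by
  have h0 := Tendsto.const_mul (K : ℝ) hf
  rw [mul_zero] at h0
  refine squeeze_zero' (Eventually.of_forall fun E => Finset.sum_nonneg fun i _ => dist_nonneg)
    ?_ h0
  have : ∀ᶠ E in AbsolutelyContinuousOnInterval.totalLengthFilter ⊓
      𝓟 (AbsolutelyContinuousOnInterval.disjWithin a b),
      E ∈ AbsolutelyContinuousOnInterval.disjWithin a b :=
    eventually_inf_principal.2 (Eventually.of_forall fun _ h => h)
  filter_upwards [this] with E hE
  rw [Finset.mul_sum]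
  exact Finset.sum_le_sum fun i hi =>
    hg.dist_le_mul _ (hs (hE.1 i hi).1) _ (hs (hE.1 i hi).2)

variable {E : Type*} [NormedAddCommGroup E] [NormedSpace ℝ E]

/-- The mean value inequality for absolutely continuous functions. -/
theorem norm_sub_le_of_ae_hasDerivAt {f : ℝ → E} {a b C : ℝ} (hab : a ≤ b)
    (hf : AbsolutelyContinuousOnInterval f a b)
    (hf' : ∀ᵐ t, t ∈ Icc a b → ∃ v, HasDerivAt f v t ∧ ‖v‖ ≤ C) :
    ‖f b - f a‖ ≤ C * (b - a) := by
  -- A norming functional reduces the claim to the fundamental theorem of calculus for the scalar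
  -- function `ℓ ∘ f`.
  obtain ⟨ℓ, hℓ, hℓ'⟩ := exists_dual_vector'' ℝ (f b - f a)
  have hac : AbsolutelyContinuousOnInterval (ℓ ∘ f) a b :=
    absolutelyContinuousOnInterval_lipschitzOnWith_comp (ℓ.lipschitz.lipschitzOnWith (s := univ)) hf
      (mapsTo_univ _ _)
  have hint := hac.integral_deriv_eq_sub
  have hle := intervalIntegral.norm_integral_le_of_norm_le_const_ae (a := a) (b := b) (C := C)
    (f := deriv (ℓ ∘ f)) (by
      filter_upwards [hf'] with t ht hmem
      rw [uIoc_of_le hab] at hmem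
      obtain ⟨v, hv, hvC⟩ := ht (Ioc_subset_Icc_self hmem)
      have : deriv (ℓ ∘ f) t = ℓ v := (ℓ.hasFDerivAt.comp_hasDerivAt t hv).deriv
      rw [this]
      calc ‖ℓ v‖ ≤ ‖ℓ‖ * ‖v‖ := ℓ.le_opNorm v
        _ ≤ 1 * ‖v‖ := by gcongr
        _ ≤ C := by simpa using hvC)
  rw [hint, Function.comp, Function.comp, ← map_sub, hℓ', abs_of_nonneg (sub_nonneg.2 hab)] at hle
  simpa using hle

theorem lipschitzOnWith_of_ae_hasDerivAt {f : ℝ → E} {a b : ℝ} {C : ℝ≥0} (hab : a ≤ b)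
    (hf : AbsolutelyContinuousOnInterval f a b)
    (hf' : ∀ᵐ t, t ∈ Icc a b → ∃ v, HasDerivAt f v t ∧ ‖v‖ ≤ C) :
    LipschitzOnWith C f (Icc a b) := by
  have key : ∀ s ∈ Icc a b, ∀ t ∈ Icc a b, s ≤ t → ‖f t - f s‖ ≤ C * (t - s) := by
    intro s hs t ht hst
    have hsub : Icc s t ⊆ Icc a b := Icc_subset_Icc hs.1 ht.2
    refine norm_sub_le_of_ae_hasDerivAt hst (hf.mono ?_) ?_
    · rwa [uIcc_of_le hst, uIcc_of_le hab]
    · filter_upwards [hf'] with r hr hmem using hr (hsub hmem)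
  refine LipschitzOnWith.of_dist_le_mul fun s hs t ht => ?_
  rcases le_total s t with h | h
  · rw [dist_comm, dist_eq_norm, dist_comm, Real.dist_eq, abs_of_nonneg (sub_nonneg.2 h)]
    exact key s hs t ht h
  · rw [dist_eq_norm, Real.dist_eq, abs_of_nonneg (sub_nonneg.2 h)]
    exact key t ht s hs h

end AbsoluteContinuity

/-! ### Lipschitz continuity of `W^{1,∞}` functions by mollification -/

section Sobolev

variable {E : Type*} [NormedAddCommGroup E] [NormedSpace ℝ E] [CompleteSpace E]

open scoped Convolution
open ContinuousLinearMap

/-- A function in `W^{1,∞}` is Lipschitz continuous. -/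
theorem MemW1Infty.exists_lipschitzOnWith {f : ℝ → E} (hf : MemW1Infty f) :
    ∃ K, LipschitzOnWith K f (Ici 0) := by
  obtain ⟨v, hv, hweak⟩ := hf.exists_weakDeriv
  set K : ℝ≥0 := (eLpNorm v ∞ (volume.restrict (Ici 0))).toNNReal with hK
  have hvK : ∀ᵐ t ∂(volume.restrict (Ici (0 : ℝ))), ‖v t‖ ≤ K := by
    have h := ae_le_eLpNormEssSup (f := v) (μ := volume.restrict (Ici (0 : ℝ)))
    filter_upwards [h] with t ht
    rw [← eLpNorm_exponent_top, ← ENNReal.coe_toNNReal hv.2.ne, ← hK] at ht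
    exact_mod_cast ht
  set F : ℝ → E := (Ici (0 : ℝ)).indicator f with hF
  have hFm : AEStronglyMeasurable F volume :=
    (aestronglyMeasurable_indicator_iff measurableSet_Ici).2 hf.memLp.1
  have hFloc : LocallyIntegrable F volume := by
    have : MemLp F ∞ volume := (memLp_indicator_iff_restrict measurableSet_Ici).2 hf.memLp
    exact this.locallyIntegrable le_top
  -- the mollified function has derivative bounded by `K`
  have hmoll : ∀ (ρ : ContDiffBump (0 : ℝ)) (x : ℝ), ρ.rOut < x →
      ∃ w, HasDerivAt (ρ.normed volume ⋆[lsmul ℝ ℝ, volume] F) w x ∧ ‖w‖ ≤ K := by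
    intro ρ x hx
    refine ⟨_, ρ.hasCompactSupport_normed.hasDerivAt_convolution_left (lsmul ℝ ℝ)
      ρ.contDiff_normed hFloc x, ?_⟩
    -- The reflected kernel is an admissible test function exactly because `ρ.rOut < x` keeps its
    -- support in `(0, ∞)`.
    set ψ : ℝ → ℝ := fun t => ρ.normed volume (x - t) with hψ
    have hψs : ContDiff ℝ ∞ ψ := ρ.contDiff_normed.comp (contDiff_const.sub contDiff_id)
    have hψc : HasCompactSupport ψ :=
      ρ.hasCompactSupport_normed.comp_homeomorph (Homeomorph.subLeft x)
    have hψt : tsupport ψ ⊆ Ioi 0 := by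
      have : tsupport ψ ⊆ Metric.closedBall x ρ.rOut := by
        refine closure_minimal (fun t ht => ?_) Metric.isClosed_closedBall
        have h1 : x - t ∈ Function.support (ρ.normed volume) := ht
        rw [ρ.support_normed_eq] at h1
        rw [Metric.mem_ball, dist_zero_right, Real.norm_eq_abs] at h1
        rw [Metric.mem_closedBall, Real.dist_eq, abs_sub_comm]
        exact h1.le
      intro t ht
      have := this ht
      rw [Metric.mem_closedBall, Real.dist_eq] at this
      have := (abs_le.1 this).1
      rw [mem_Ioi]; linarith
    have hd : ∀ t, deriv ψ t = - deriv (ρ.normed volume) (x - t) := fun t =>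
      deriv_comp_const_sub (ρ.normed volume) x t
    have h1 : (deriv (ρ.normed volume) ⋆[lsmul ℝ ℝ, volume] F) x
        = ∫ t in Ici (0 : ℝ), ψ t • v t := by
      rw [convolution_eq_swap]
      have h2 := hweak ψ hψs hψc hψt
      rw [← neg_inj, ← h2, ← integral_neg, ← integral_indicator measurableSet_Ici]
      congr 1
      ext t
      by_cases ht : t ∈ Ici (0 : ℝ)
      · simp [hF, ht, hd, lsmul_apply]
      · simp [hF, ht, lsmul_apply]
    rw [h1]
    have hψi : Integrable ψ volume := hψs.continuous.integrable_of_hasCompactSupport hψc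
    -- The kernel is nonnegative with total mass `1`, so averaging `v` cannot exceed its essential
    -- bound.
    calc ‖∫ t in Ici (0 : ℝ), ψ t • v t‖ ≤ ∫ t in Ici (0 : ℝ), ψ t * K := by
          refine norm_integral_le_of_norm_le (hψi.integrableOn.mul_const _) ?_
          filter_upwards [hvK] with t ht
          rw [norm_smul, Real.norm_of_nonneg (ρ.nonneg_normed _)]
          gcongr
          exact ρ.nonneg_normed _
      _ = (∫ t in Ici (0 : ℝ), ψ t) * K := integral_mul_const _ _
      _ ≤ (∫ t, ψ t) * K := by
          gcongr
          · exact Eventually.of_forall fun t => ρ.nonneg_normed _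
          · exact Measure.restrict_le_self
      _ = K := by
          rw [hψ, integral_sub_left_eq_self (fun t => ρ.normed volume t), ρ.integral_normed, one_mul]
  -- pass to the limit
  have hIoi : LipschitzOnWith K f (Ioi 0) := by
    let ρ : ℕ → ContDiffBump (0 : ℝ) := fun n =>
      ⟨1 / ((n : ℝ) + 1) / 2, 1 / ((n : ℝ) + 1), by positivity, half_lt_self (by positivity)⟩
    have hρ : Tendsto (fun n => (ρ n).rOut) atTop (𝓝 0) := tendsto_one_div_add_atTop_nhds_zero_nat
    have hlim : ∀ x > 0, Tendsto (fun n => ((ρ n).normed volume ⋆[lsmul ℝ ℝ, volume] F) x) atTop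
        (𝓝 (f x)) := by
      intro x hx
      refine ContDiffBump.convolution_tendsto_right (g := fun _ => F) hρ
        (Eventually.of_forall fun _ => hFm) ?_ tendsto_const_nhds
      have : Tendsto F (𝓝 x) (𝓝 (f x)) := by
        refine Tendsto.congr' ?_ (hf.continuousOn.continuousAt (Ici_mem_nhds hx))
        filter_upwards [Ici_mem_nhds hx] with t ht
        simp only [hF, indicator_of_mem ht]
      exact this.comp tendsto_snd
    refine LipschitzOnWith.of_dist_le_mul fun x hx y hy => ?_
    -- Each mollification is `K`-Lipschitz only beyond its radius; both points eventually lie there.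
    have hev : ∀ᶠ n in atTop, (ρ n).rOut < min x y := hρ.eventually_lt_const (lt_min hx hy)
    refine le_of_tendsto ((hlim x hx).dist (hlim y hy)) ?_
    filter_upwards [hev] with n hn
    refine (Convex.lipschitzOnWith_of_nnnorm_deriv_le (s := Ioi (ρ n).rOut) (C := K)
      (f := (ρ n).normed volume ⋆[lsmul ℝ ℝ, volume] F) (𝕜 := ℝ) (fun t ht => ?_) (fun t ht => ?_)
      (convex_Ioi _)).dist_le_mul x (lt_min_iff.1 hn).1 y (lt_min_iff.1 hn).2
    · exact (hmoll (ρ n) t ht).choose_spec.1.differentiableAt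
    · rw [(hmoll (ρ n) t ht).choose_spec.1.deriv]
      exact (hmoll (ρ n) t ht).choose_spec.2
  refine ⟨K, ?_⟩
  have := hIoi.closure (by rw [closure_Ioi]; exact hf.continuousOn)
  rwa [closure_Ioi] at this

end Sobolev

/-! ### Bounds on the vector field, regularity and uniqueness of responses -/

namespace ControlSystem

theorem ae_norm_le_of_control_norm_le {Y : Type*} [NormedAddCommGroup Y] {T t₀ M : ℝ} {u : Control Y T t₀} (hu : ‖u‖ ≤ M) :
    ∀ᵐ t, t ∈ Icc t₀ (t₀ + T) → ‖u t‖ ≤ M := by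
  rw [← ae_restrict_iff' measurableSet_Icc]
  filter_upwards [ae_le_eLpNormEssSup (f := u) (μ := volume.restrict (Icc t₀ (t₀ + T)))] with t ht
  rw [← eLpNorm_exponent_top] at ht
  refine le_trans ?_ hu
  rw [Lp.norm_def, ← toReal_enorm]
  exact ENNReal.toReal_mono (Lp.eLpNorm_ne_top u) ht

variable {X Y : Type*} [NormedAddCommGroup X] [NormedSpace ℝ X]
  [NormedAddCommGroup Y] [NormedSpace ℝ Y]

section Bounds

variable [FiniteDimensional ℝ X]

theorem exists_field_bound (S : ControlSystem X Y) (R M : ℝ) :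
    ∃ C : ℝ≥0, ∀ x, ‖x‖ ≤ R → ∀ u, ‖u‖ ≤ M → ‖S.f x + S.g x u‖ ≤ C := by
  obtain ⟨A, hA⟩ := (isCompact_closedBall (0 : X) R).exists_bound_of_continuousOn
    S.contDiff_f.continuous.continuousOn
  obtain ⟨B, hB⟩ := (isCompact_closedBall (0 : X) R).exists_bound_of_continuousOn
    S.contDiff_g.continuous.continuousOn
  refine ⟨(A + B * M).toNNReal, fun x hx u hu => le_trans ?_ (Real.le_coe_toNNReal _)⟩
  have hx' : x ∈ Metric.closedBall (0 : X) R := by simpa using hx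
  have hB0 : 0 ≤ B := (norm_nonneg _).trans (hB x hx')
  calc ‖S.f x + S.g x u‖ ≤ ‖S.f x‖ + ‖S.g x‖ * ‖u‖ :=
        (norm_add_le _ _).trans (by gcongr; exact (S.g x).le_opNorm u)
    _ ≤ A + B * M := by
        gcongr
        · exact hA x hx'
        · exact hB x hx'

theorem exists_field_lipschitz (S : ControlSystem X Y) (R M : ℝ) :
    ∃ K : ℝ≥0, ∀ x, ‖x‖ ≤ R → ∀ z, ‖z‖ ≤ R → ∀ u, ‖u‖ ≤ M →
      ‖(S.f x + S.g x u) - (S.f z + S.g z u)‖ ≤ K * ‖x - z‖ := by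
  obtain ⟨A, hA⟩ := S.contDiff_f.contDiffOn.exists_lipschitzOnWith one_ne_zero
    (convex_closedBall (0 : X) R) (isCompact_closedBall (0 : X) R)
  obtain ⟨B, hB⟩ := S.contDiff_g.contDiffOn.exists_lipschitzOnWith one_ne_zero
    (convex_closedBall (0 : X) R) (isCompact_closedBall (0 : X) R)
  refine ⟨A + B * M.toNNReal, fun x hx z hz u hu => ?_⟩
  have hx' : x ∈ Metric.closedBall (0 : X) R := by simpa using hx
  have hz' : z ∈ Metric.closedBall (0 : X) R := by simpa using hz
  have hu' : ‖u‖ ≤ M.toNNReal := hu.trans (Real.le_coe_toNNReal _)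
  have h1 := hA.dist_le_mul x hx' z hz'
  have h2 := hB.dist_le_mul x hx' z hz'
  rw [dist_eq_norm, dist_eq_norm] at h1 h2
  calc ‖(S.f x + S.g x u) - (S.f z + S.g z u)‖ = ‖(S.f x - S.f z) + (S.g x - S.g z) u‖ := by
        rw [sub_apply, add_sub_add_comm]
    _ ≤ ‖S.f x - S.f z‖ + ‖S.g x - S.g z‖ * ‖u‖ :=
        (norm_add_le _ _).trans (by gcongr; exact (S.g x - S.g z).le_opNorm u)
    _ ≤ A * ‖x - z‖ + B * ‖x - z‖ * M.toNNReal := by gcongr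
    _ = (A + B * M.toNNReal : ℝ≥0) * ‖x - z‖ := by push_cast; ring

end Bounds

section Response

variable {S : ControlSystem X Y} {T t₀ : ℝ} {x₀ : X} {u : Control Y T t₀} {x z : ℝ → X}

theorem IsResponse.ae_imp_hasDerivAt (hx : S.IsResponse T t₀ x₀ u x) :
    ∀ᵐ t, t ∈ Icc t₀ (t₀ + T) → HasDerivAt x (S.f (x t) + S.g (x t) (u t)) t :=
  (ae_restrict_iff' measurableSet_Icc).1 (IsCaratheodorySolution.ae_hasDerivAt hx)

theorem IsResponse.continuousOn (hT : 0 ≤ T) (hx : S.IsResponse T t₀ x₀ u x) :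
    ContinuousOn x (Icc t₀ (t₀ + T)) := by
  have := hx.absolutelyContinuous.continuousOn
  rwa [uIcc_of_le (by linarith)] at this

theorem IsResponse.exists_bound (hT : 0 ≤ T) (hx : S.IsResponse T t₀ x₀ u x) :
    ∃ R, ∀ t ∈ Icc t₀ (t₀ + T), ‖x t‖ ≤ R :=
  isCompact_Icc.exists_bound_of_continuousOn (hx.continuousOn hT)

theorem IsResponse.lipschitzOnWith {R M : ℝ} {C : ℝ≥0} (hT : 0 ≤ T)
    (hC : ∀ x, ‖x‖ ≤ R → ∀ u, ‖u‖ ≤ M → ‖S.f x + S.g x u‖ ≤ C) (hu : ‖u‖ ≤ M)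
    (hx : S.IsResponse T t₀ x₀ u x) (hR : ∀ t ∈ Icc t₀ (t₀ + T), ‖x t‖ ≤ R) :
    LipschitzOnWith C x (Icc t₀ (t₀ + T)) := by
  refine lipschitzOnWith_of_ae_hasDerivAt (by linarith) hx.absolutelyContinuous ?_
  filter_upwards [hx.ae_imp_hasDerivAt, ae_norm_le_of_control_norm_le hu] with t h1 h2 ht
  exact ⟨_, h1 ht, hC _ (hR t ht) _ (h2 ht)⟩

/-- Both trajectories lie in a ball on which the field is Lipschitz in the state, uniformly in the
control values, so Grönwall applies to `‖x - z‖`. Since derivatives exist only almost everywhere, a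
version with right difference quotients is used, and these are bounded at every point through the
mean value inequality. -/
theorem IsResponse.eqOn [FiniteDimensional ℝ X] (hT : 0 ≤ T) (hx : S.IsResponse T t₀ x₀ u x)
    (hz : S.IsResponse T t₀ x₀ u z) : EqOn x z (Icc t₀ (t₀ + T)) := by
  obtain ⟨R₁, hR₁⟩ := hx.exists_bound hT
  obtain ⟨R₂, hR₂⟩ := hz.exists_bound hT
  obtain ⟨K, hK⟩ := S.exists_field_lipschitz (max R₁ R₂) ‖u‖
  have hD : ContinuousOn (fun t => x t - z t) (Icc t₀ (t₀ + T)) :=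
    (hx.continuousOn hT).sub (hz.continuousOn hT)
  have key : ∀ s ∈ Icc t₀ (t₀ + T), ∀ t ∈ Icc t₀ (t₀ + T), s ≤ t → ∀ A,
      (∀ r ∈ Icc s t, ‖x r - z r‖ ≤ A) → ‖(x t - z t) - (x s - z s)‖ ≤ K * A * (t - s) := by
    intro s hs t ht hst A hA
    have hsub : Icc s t ⊆ Icc t₀ (t₀ + T) := Icc_subset_Icc hs.1 ht.2
    refine norm_sub_le_of_ae_hasDerivAt (f := x - z) hst
      ((hx.absolutelyContinuous.sub hz.absolutelyContinuous).mono ?_) ?_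
    · rwa [uIcc_of_le hst, uIcc_of_le (by linarith)]
    · filter_upwards [hx.ae_imp_hasDerivAt, hz.ae_imp_hasDerivAt, ae_norm_le_of_control_norm_le (u := u) le_rfl]
        with r h1 h2 h3 hr
      have hr' := hsub hr
      refine ⟨_, (h1 hr').sub (h2 hr'), (hK _ ((hR₁ r hr').trans (le_max_left _ _)) _
        ((hR₂ r hr').trans (le_max_right _ _)) _ (h3 hr')).trans ?_⟩
      gcongr
      exact hA r hr
  have hgr := le_gronwallBound_of_liminf_deriv_right_le (f := fun t => ‖x t - z t‖)
    (f' := fun t => K * ‖x t - z t‖) (δ := 0) (K := K) (ε := 0) hD.norm (fun s hs r hr => ?_)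
    (by rw [hx.initial, hz.initial]; simp) (fun s _ => by simp)
  · intro t ht
    have := hgr t ht
    rw [gronwallBound_ε0, zero_mul] at this
    exact sub_eq_zero.1 (norm_le_zero_iff.1 this)
  · refine Eventually.frequently ?_
    -- `A` is slightly above `‖x s - z s‖`: by continuity it still bounds the difference just to the
    -- right of `s`, while `K * A < r`.
    obtain ⟨A, hA1, hA2⟩ : ∃ A, ‖x s - z s‖ < A ∧ K * A < r := by
      have hcont : Tendsto (fun A : ℝ => K * A) (𝓝[>] ‖x s - z s‖) (𝓝 (K * ‖x s - z s‖)) :=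
        ((continuous_const.mul continuous_id).tendsto _).mono_left nhdsWithin_le_nhds
      have := (hcont.eventually_lt_const hr).and self_mem_nhdsWithin
      obtain ⟨A, h1, h2⟩ := this.exists
      exact ⟨A, h2, h1⟩
    have hsI : s ∈ Icc t₀ (t₀ + T) := Ico_subset_Icc_self hs
    have hev : ∀ᶠ t in 𝓝[Icc s (t₀ + T)] s, ‖x t - z t‖ < A :=
      ((hD.norm s hsI).mono (Icc_subset_Icc_left hs.1)).eventually_lt_const hA1
    rw [nhdsWithin_Icc_eq_nhdsGE hs.2] at hev
    obtain ⟨q, hq1, hq2⟩ := mem_nhdsGE_iff_exists_Icc_subset.1 hev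
    filter_upwards [Ioo_mem_nhdsGT (lt_min hq1 hs.2)] with t ht
    have ht1 : t < q := ht.2.trans_le (min_le_left _ _)
    have ht2 : t < t₀ + T := ht.2.trans_le (min_le_right _ _)
    have hts : 0 < t - s := sub_pos.2 ht.1
    have hb := key s hsI t ⟨hsI.1.trans ht.1.le, ht2.le⟩ ht.1.le A fun p hp =>
      (hq2 ⟨hp.1, hp.2.trans ht1.le⟩ : ‖x p - z p‖ < A).le
    have hb' := (norm_sub_norm_le _ _).trans hb
    rw [inv_mul_lt_iff₀ hts]
    calc _ ≤ K * A * (t - s) := hb'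
      _ < (t - s) * r := by rw [mul_comm]; gcongr

theorem isResponse_response (hu : u ∈ S.feasibleControls T t₀ x₀) :
    S.IsResponse T t₀ x₀ u (S.response T t₀ x₀ u) := by
  have h : ∃ x, S.IsResponse T t₀ x₀ u x := hu
  rw [response, dif_pos h]
  exact h.choose_spec

end Response

/-! ### A uniform state bound from the BIBS condition -/

section StateBound

theorem exists_pos_le_of_mem_funnelFunctions {φ : ℝ → ℝ} (hφ : φ ∈ funnelFunctions) :
    ∃ δ > 0, ∀ t ≥ 0, δ ≤ φ t := by
  refine ⟨_, hφ.2, fun t ht => csInf_le ?_ (mem_image_of_mem φ ht)⟩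
  by_contra hb
  have := hφ.2
  rw [Real.sInf_of_not_bddBelow hb] at this
  exact lt_irrefl _ this

/-- The responses that evolve in the funnel are bounded, uniformly in the control. -/
theorem exists_response_bound [FiniteDimensional ℝ X] [FiniteDimensional ℝ Y]
    (S : ControlSystem X Y) (hS : S.InSystemClass) {φ : ℝ → ℝ} (hφ : φ ∈ funnelFunctions)
    {yref : ℝ → Y} (hyref : MemW1Infty yref) {T t₀ : ℝ} (hT : 0 ≤ T) (ht₀ : 0 ≤ t₀) (x₀ : X) :
    ∃ R, ∀ (u : Control Y T t₀) (x : ℝ → X), S.IsResponse T t₀ x₀ u x →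
      (∀ t ∈ Icc t₀ (t₀ + T), x t ∈ S.funnelStates φ yref t) →
        ∀ t ∈ Icc t₀ (t₀ + T), ‖x t‖ ≤ R := by
  have hIcc : Icc t₀ (t₀ + T) ⊆ Ici 0 := fun t ht => ht₀.trans ht.1
  have hle : t₀ ≤ t₀ + T := by linarith
  obtain ⟨δ, hδ, hφδ⟩ := exists_pos_le_of_mem_funnelFunctions hφ
  obtain ⟨B, hB⟩ := isCompact_Icc.exists_bound_of_continuousOn (hyref.continuousOn.mono hIcc)
  obtain ⟨Φ, p, q, hΦ, hq⟩ := hS.bibs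
  -- Inside the funnel `‖y - yref‖ ≤ 1/δ`, and `|B|` bounds `yref`; adding the initial internal
  -- state gives the radius for the BIBS condition.
  set c₀ : ℝ := ‖(Φ x₀).2‖ + (1 / δ + |B|) with hc₀
  obtain ⟨c₁, -, hc₁⟩ := hq c₀ (by positivity)
  obtain ⟨R, hR⟩ := ((isCompact_closedBall (0 : Y) (1 / δ + |B|)).prod
    (isCompact_closedBall (0 : InternalSpace X Y) c₁)).exists_bound_of_continuousOn
      hΦ.contDiff_symm.continuous.continuousOn
  refine ⟨R, fun u x hx hfun => ?_⟩
  have hxc := hx.continuousOn hT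
  have hy : ∀ t ∈ Icc t₀ (t₀ + T), ‖S.h (x t)‖ ≤ 1 / δ + |B| := by
    intro t ht
    have h1 : φ t * ‖S.h (x t) - yref t‖ < 1 := hfun t ht
    have h2 : ‖S.h (x t) - yref t‖ ≤ 1 / δ := by
      rw [le_div_iff₀ hδ, mul_comm]
      exact (mul_le_mul_of_nonneg_right (hφδ t (hIcc ht)) (norm_nonneg _)).trans h1.le
    have h3 : ‖yref t‖ ≤ |B| := (hB t ht).trans (le_abs_self B)
    calc ‖S.h (x t)‖ = ‖(S.h (x t) - yref t) + yref t‖ := by rw [sub_add_cancel]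
      _ ≤ _ := (norm_add_le _ _).trans (add_le_add h2 h3)
  -- The BIBS condition takes inputs on all of `[t₀, ∞)`, so the output is extended by zero.
  set y : ℝ → Y := (Icc t₀ (t₀ + T)).indicator (fun t => S.h (x t)) with hydef
  have hyc : ContinuousOn (fun t => S.h (x t)) (Icc t₀ (t₀ + T)) :=
    S.contDiff_h.continuous.comp_continuousOn hxc
  have hym : AEStronglyMeasurable y volume :=
    (aestronglyMeasurable_indicator_iff measurableSet_Icc).2
      (hyc.aestronglyMeasurable measurableSet_Icc)
  have hyb : ∀ t, ‖y t‖ ≤ 1 / δ + |B| := by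
    intro t
    by_cases ht : t ∈ Icc t₀ (t₀ + T)
    · simpa only [hydef, indicator_of_mem ht] using hy t ht
    · simp only [hydef, indicator_of_notMem ht, norm_zero]; positivity
  have hη : ∀ t ∈ Icc t₀ (t₀ + T), ‖(Φ (x t)).2‖ ≤ c₁ := by
    refine hc₁ t₀ ht₀ (Φ x₀).2 y hym.restrict ?_ (t₀ + T) hle (fun t => (Φ (x t)).2) ?_
    · rw [hc₀, ENNReal.ofReal_add (norm_nonneg _) (by positivity), ofReal_norm]
      gcongr
      rw [eLpNorm_exponent_top]
      exact eLpNormEssSup_le_of_ae_bound (Eventually.of_forall hyb)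
    · obtain ⟨R', hR'⟩ := hx.exists_bound hT
      have hlip : ContDiff ℝ 1 fun x => (Φ x).2 := hΦ.contDiff_toFun.snd
      obtain ⟨A, hA⟩ := hlip.contDiffOn.exists_lipschitzOnWith one_ne_zero
        (convex_closedBall (0 : X) R') (isCompact_closedBall (0 : X) R')
      have hmaps : MapsTo x (uIcc t₀ (t₀ + T)) (Metric.closedBall (0 : X) R') := by
        rw [uIcc_of_le hle]
        intro t ht
        simpa using hR' t ht
      have hxac : AbsolutelyContinuousOnInterval x t₀ (t₀ + T) := hx.absolutelyContinuous
      have hac := absolutelyContinuousOnInterval_lipschitzOnWith_comp hA hxac hmaps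
      refine ⟨hac, congrArg (fun x => (Φ x).2) hx.initial, ?_⟩
      · rw [ae_restrict_iff' measurableSet_Icc]
        filter_upwards [hx.ae_imp_hasDerivAt] with t ht hmem
        have h1 : HasDerivAt (fun t => Φ (x t))
            (fderiv ℝ Φ (x t) (S.f (x t) + S.g (x t) (u t))) t :=
          ((hΦ.contDiff_toFun.differentiable one_ne_zero (x t)).hasFDerivAt).comp_hasDerivAt t
            (ht hmem)
        have h2 := hΦ.transform (Φ (x t)) (u t)
        rw [Φ.symm_apply_apply] at h2
        rw [h2] at h1
        have h3 : Φ (x t) = (y t, (Φ (x t)).2) := by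
          rw [hydef, indicator_of_mem hmem, ← hΦ.output]
        rw [← h3]
        exact h1.snd
  intro t ht
  have := hR (Φ (x t)) ⟨by simpa [hΦ.output] using hy t ht, by simpa using hη t ht⟩
  rwa [Φ.symm_apply_apply] at this

end StateBound

end ControlSystem

/-! ### Compactness of equi-Lipschitz sequences -/

section Sequences

/-- A consequence of the Arzelà-Ascoli theorem. -/
theorem exists_subseq_tendsto_of_lipschitzOnWith {E : Type*} [NormedAddCommGroup E] [ProperSpace E]
    {a b : ℝ} (hab : a ≤ b) {K : ℝ≥0} {R : ℝ} {Z : ℕ → ℝ → E}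
    (hZ : ∀ k, LipschitzOnWith K (Z k) (Icc a b)) (hR : ∀ k, ∀ t ∈ Icc a b, ‖Z k t‖ ≤ R) :
    ∃ σ : ℕ → ℕ, StrictMono σ ∧ ∃ W : ℝ → E, LipschitzWith K W ∧
      ∀ t ∈ Icc a b, Tendsto (fun k => Z (σ k) t) atTop (𝓝 (W t)) := by
  have hlip : ∀ k, LipschitzWith K ((Icc a b).domRestrict (Z k)) := fun k => (hZ k).to_restrict
  let F : ℕ → BoundedContinuousFunction (Icc a b) E := fun k =>
    BoundedContinuousFunction.mkOfCompact ⟨(Icc a b).domRestrict (Z k), (hlip k).continuous⟩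
  have hcomp : IsCompact (closure (range F)) := by
    refine BoundedContinuousFunction.arzela_ascoli (Metric.closedBall 0 R)
      (isCompact_closedBall 0 R) (range F) ?_ ?_
    · rintro _ t ⟨k, rfl⟩
      exact mem_closedBall_zero_iff.2 (hR k t t.2)
    · refine (LipschitzWith.uniformEquicontinuous _ K ?_).equicontinuous
      rintro ⟨_, k, rfl⟩
      exact hlip k
  obtain ⟨G, -, σ, hσ, hG⟩ := hcomp.tendsto_subseq (x := F) fun k => subset_closure ⟨k, rfl⟩
  have hpt : ∀ t : Icc a b, Tendsto (fun k => Z (σ k) t) atTop (𝓝 (G t)) := fun t =>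
    (BoundedContinuousFunction.tendsto_iff_tendstoUniformly.1 hG).tendsto_at t
  have hGlip : LipschitzWith K G := LipschitzWith.of_dist_le_mul fun s t =>
    le_of_tendsto ((hpt s).dist (hpt t)) (Eventually.of_forall fun k => (hlip _).dist_le_mul s t)
  -- Extending by constants makes the limit Lipschitz on the whole line, so that its components are
  -- differentiable almost everywhere there.
  refine ⟨σ, hσ, G ∘ projIcc a b hab, ?_, fun t ht => ?_⟩
  · simpa using hGlip.comp (LipschitzWith.projIcc hab)
  · simpa [projIcc_of_mem hab ht] using hpt ⟨t, ht⟩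

theorem norm_le_mul_of_lipschitzOnWith {E : Type*} [NormedAddCommGroup E] {L : ℝ≥0} {w : ℝ → E}
    {a T : ℝ} (hw : LipschitzOnWith L w (Icc a (a + T))) (h0 : w a = 0) {t : ℝ}
    (ht : t ∈ Icc a (a + T)) : ‖w t‖ ≤ L * T := by
  have h1 := hw.dist_le_mul t ht a (left_mem_Icc.2 (ht.1.trans ht.2))
  rw [h0, dist_zero_right, Real.dist_eq, abs_of_nonneg (sub_nonneg.2 ht.1)] at h1
  refine h1.trans ?_
  gcongr
  linarith [ht.2]

end Sequences

/-! ### Differentiating limits of expansions and energy inequalities -/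

section Differentiation

variable {E F : Type*} [NormedAddCommGroup E] [NormedSpace ℝ E]
  [NormedAddCommGroup F] [NormedSpace ℝ F]

/-- Up to a quadratic error, the increments of `x` are linear in those of `U`, so `x` inherits
differentiability from `U`. This recovers the differential equation for a limit trajectory from an
estimate stable under pointwise limits. -/
theorem hasDerivAt_of_norm_sub_le_sq {x : ℝ → E} {U : ℝ → F} {A : E} {B : F →L[ℝ] E} {w : F}
    {t D : ℝ} (h : ∀ᶠ s in 𝓝 t, ‖x s - x t - ((s - t) • A + B (U s - U t))‖ ≤ D * |s - t| ^ 2)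
    (hU : HasDerivAt U w t) : HasDerivAt x (A + B w) t := by
  rw [hasDerivAt_iff_isLittleO] at hU ⊢
  have h1 : (fun s => x s - x t - ((s - t) • A + B (U s - U t))) =o[𝓝 t] fun s => s - t := by
    have h2 : (fun s => x s - x t - ((s - t) • A + B (U s - U t))) =O[𝓝 t]
        fun s => (s - t) ^ 2 := by
      refine Asymptotics.IsBigO.of_bound D ?_
      filter_upwards [h] with s hs
      simpa using hs
    refine h2.trans_isLittleO ?_
    have h3 : (fun s : ℝ => s - t) =o[𝓝 t] fun _ => (1 : ℝ) := by
      rw [Asymptotics.isLittleO_one_iff]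
      have : Continuous fun s : ℝ => s - t := by fun_prop
      simpa using this.tendsto t
    simpa [sq] using h3.mul_isBigO (Asymptotics.isBigO_refl (fun s : ℝ => s - t) (𝓝 t))
  have h4 : (fun s => B (U s - U t - (s - t) • w)) =o[𝓝 t] fun s => s - t :=
    (B.isBigO_comp _ _).trans_isLittleO hU
  refine (h1.add h4).congr_left fun s => ?_
  simp only [map_sub, map_smul, smul_add]
  abel

/-- Divide the hypothesis by `(s - t)²` and let `s` decrease to `t`. -/
theorem norm_sq_le_of_norm_sub_sq_le {U : ℝ → F} {c : ℝ → ℝ} {w : F} {e t : ℝ}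
    (h : ∀ᶠ s in 𝓝[>] t, ‖U s - U t‖ ^ 2 ≤ (s - t) * (c s - c t))
    (hU : HasDerivAt U w t) (hc : HasDerivAt c e t) : ‖w‖ ^ 2 ≤ e := by
  have hle : 𝓝[>] t ≤ 𝓝[≠] t := nhdsGT_le_nhdsNE t
  refine le_of_tendsto_of_tendsto
    (((hasDerivAt_iff_tendsto_slope.1 hU).mono_left hle).norm.pow 2)
    ((hasDerivAt_iff_tendsto_slope.1 hc).mono_left hle) ?_
  filter_upwards [h, self_mem_nhdsWithin] with s hs hst
  have hpos : 0 < s - t := sub_pos.2 hst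
  rw [slope_def_module, slope_def_field, norm_smul, norm_inv, Real.norm_of_nonneg hpos.le, mul_pow,
    le_div_iff₀ hpos]
  calc (s - t)⁻¹ ^ 2 * ‖U s - U t‖ ^ 2 * (s - t)
      ≤ (s - t)⁻¹ ^ 2 * ((s - t) * (c s - c t)) * (s - t) := by gcongr
    _ = c s - c t := by field_simp

/-- The hypothesis survives pointwise limits of `U` and `c`, so this acts as weak lower
semicontinuity of the energy: it differentiates to `‖U'‖² ≤ c'` almost everywhere, which is then
integrated. -/
theorem lintegral_norm_deriv_sq_le [FiniteDimensional ℝ F] {U : ℝ → F} {c : ℝ → ℝ} {K L : ℝ≥0}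
    {a b : ℝ} (hab : a ≤ b) (hU : LipschitzWith K U) (hc : LipschitzWith L c)
    (h : ∀ s ∈ Icc a b, ∀ t ∈ Icc a b, s ≤ t → ‖U t - U s‖ ^ 2 ≤ (t - s) * (c t - c s)) :
    ∫⁻ t in Icc a b, ENNReal.ofReal (‖deriv U t‖ ^ 2) ≤ ENNReal.ofReal (c b - c a) := by
  have hae : ∀ᵐ t, t ∈ Ioc a b → ‖deriv U t‖ ^ 2 ≤ deriv c t := by
    filter_upwards [hU.ae_differentiableAt_real, hc.ae_differentiableAt_real,
      compl_mem_ae_iff.2 (measure_singleton b)]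
      with t h1 h2 h3 ht
    have htb : t < b := lt_of_le_of_ne ht.2 h3
    refine norm_sq_le_of_norm_sub_sq_le ?_ h1.hasDerivAt h2.hasDerivAt
    filter_upwards [Ioo_mem_nhdsGT htb] with s hs
    exact h t ⟨ht.1.le, ht.2⟩ s ⟨ht.1.le.trans hs.1.le, hs.2.le⟩ hs.1.le
  have hac : AbsolutelyContinuousOnInterval c a b :=
    hc.lipschitzOnWith.absolutelyContinuousOnInterval
  have hint := hac.intervalIntegrable_deriv
  rw [← hac.integral_deriv_eq_sub, intervalIntegral.integral_of_le hab,
    ofReal_integral_eq_lintegral_ofReal]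
  · rw [setLIntegral_congr (Ioc_ae_eq_Icc (μ := volume)).symm]
    refine setLIntegral_mono_ae' measurableSet_Ioc ?_
    filter_upwards [hae] with t ht hmem using ENNReal.ofReal_le_ofReal (ht hmem)
  · exact (intervalIntegrable_iff_integrableOn_Ioc_of_le hab).1 hint
  · rw [EventuallyLE, ae_restrict_iff' measurableSet_Ioc]
    filter_upwards [hae] with t ht hmem using (sq_nonneg _).trans (ht hmem)

/-- The Cauchy-Schwarz inequality for the primitive of a bounded function. -/
theorem norm_integral_sq_le {u : ℝ → F} {s t M : ℝ} (hst : s ≤ t)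
    (hu : AEStronglyMeasurable u (volume.restrict (Ioc s t)))
    (hM : ∀ᵐ r, r ∈ Ioc s t → ‖u r‖ ≤ M) :
    ‖∫ r in s..t, u r‖ ^ 2 ≤ (t - s) * ∫ r in s..t, ‖u r‖ ^ 2 := by
  rcases hst.eq_or_lt with rfl | hlt
  · simp
  have hpos : 0 < t - s := sub_pos.2 hlt
  have hM' : ∀ᵐ r ∂(volume.restrict (Ioc s t)), ‖u r‖ ≤ M :=
    (ae_restrict_iff' measurableSet_Ioc).2 hM
  have hi1 : IntervalIntegrable (fun r => ‖u r‖) volume s t := by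
    rw [intervalIntegrable_iff_integrableOn_Ioc_of_le hst]
    refine Integrable.of_bound hu.norm M ?_
    filter_upwards [hM'] with r hr
    simpa using hr
  have hi2 : IntervalIntegrable (fun r => ‖u r‖ ^ 2) volume s t := by
    rw [intervalIntegrable_iff_integrableOn_Ioc_of_le hst]
    refine Integrable.of_bound (hu.norm.pow 2) (M ^ 2) ?_
    filter_upwards [hM'] with r hr
    rw [norm_pow, norm_norm]
    gcongr
  set I₁ := ∫ r in s..t, ‖u r‖ with hI₁
  set I₂ := ∫ r in s..t, ‖u r‖ ^ 2 with hI₂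
  have h1 : ‖∫ r in s..t, u r‖ ≤ I₁ := intervalIntegral.norm_integral_le_integral_norm hst
  have h0 : 0 ≤ I₁ := (norm_nonneg _).trans h1
  -- The variance of `‖u‖` about its mean is nonnegative.
  have h2 : 0 ≤ ∫ r in s..t, (‖u r‖ - I₁ / (t - s)) ^ 2 :=
    intervalIntegral.integral_nonneg hst fun r _ => sq_nonneg _
  have h3 : ∫ r in s..t, (‖u r‖ - I₁ / (t - s)) ^ 2 = I₂ - I₁ ^ 2 / (t - s) := by
    have : ∀ r, (‖u r‖ - I₁ / (t - s)) ^ 2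
        = ‖u r‖ ^ 2 - 2 * (I₁ / (t - s)) * ‖u r‖ + (I₁ / (t - s)) ^ 2 := fun r => by ring
    simp_rw [this]
    rw [intervalIntegral.integral_add (hi2.sub (hi1.const_mul _)) intervalIntegrable_const,
      intervalIntegral.integral_sub hi2 (hi1.const_mul _), intervalIntegral.integral_const_mul,
      intervalIntegral.integral_const, ← hI₁, ← hI₂, smul_eq_mul]
    field_simp
    ring
  rw [h3, sub_nonneg, div_le_iff₀ hpos] at h2
  calc ‖∫ r in s..t, u r‖ ^ 2 ≤ I₁ ^ 2 := by gcongr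
    _ ≤ (t - s) * I₂ := by linarith

end Differentiation

/-! ### Primitives of controls and sequential compactness of responses -/

namespace ControlSystem

section Primitive

variable {Y : Type*} [NormedAddCommGroup Y] {T t₀ M : ℝ} {u : Control Y T t₀}

theorem intervalIntegrable_control (hu : ‖u‖ ≤ M) {s t : ℝ} (hs : s ∈ Icc t₀ (t₀ + T))
    (ht : t ∈ Icc t₀ (t₀ + T)) : IntervalIntegrable u volume s t := by
  rw [intervalIntegrable_iff]
  have : IsFiniteMeasure (volume.restrict (uIoc s t)) :=
    inferInstanceAs (IsFiniteMeasure (volume.restrict (Ioc (min s t) (max s t))))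
  refine Integrable.of_bound (Lp.stronglyMeasurable u).aestronglyMeasurable M ?_
  rw [ae_restrict_iff' measurableSet_uIoc]
  filter_upwards [ae_norm_le_of_control_norm_le hu] with r hr hmem
  exact hr (uIcc_subset_Icc hs ht (uIoc_subset_uIcc hmem))

theorem intervalIntegrable_control_norm_sq (hu : ‖u‖ ≤ M) {s t : ℝ} (hs : s ∈ Icc t₀ (t₀ + T))
    (ht : t ∈ Icc t₀ (t₀ + T)) : IntervalIntegrable (fun r => ‖u r‖ ^ 2) volume s t := by
  rw [intervalIntegrable_iff]
  have : IsFiniteMeasure (volume.restrict (uIoc s t)) :=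
    inferInstanceAs (IsFiniteMeasure (volume.restrict (Ioc (min s t) (max s t))))
  refine Integrable.of_bound ((Lp.stronglyMeasurable u).norm.pow 2).aestronglyMeasurable (M ^ 2) ?_
  rw [ae_restrict_iff' measurableSet_uIoc]
  filter_upwards [ae_norm_le_of_control_norm_le hu] with r hr hmem
  have := hr (uIcc_subset_Icc hs ht (uIoc_subset_uIcc hmem))
  rw [norm_pow, norm_norm]
  gcongr

theorem lipschitzOnWith_primitive {E : Type*} [NormedAddCommGroup E] [NormedSpace ℝ E]
    {a b : ℝ} {C : ℝ≥0} {v : ℝ → E}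
    (hi : ∀ s ∈ Icc a b, ∀ t ∈ Icc a b, IntervalIntegrable v volume s t)
    (hv : ∀ᵐ t, t ∈ Icc a b → ‖v t‖ ≤ C) :
    LipschitzOnWith C (fun t => ∫ r in a..t, v r) (Icc a b) := by
  refine LipschitzOnWith.of_dist_le_mul fun s hs t ht => ?_
  have ha : a ∈ Icc a b := ⟨le_rfl, hs.1.trans hs.2⟩
  rw [dist_eq_norm, intervalIntegral.integral_interval_sub_left (hi a ha s hs) (hi a ha t ht),
    Real.dist_eq]
  refine intervalIntegral.norm_integral_le_of_norm_le_const_ae ?_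
  filter_upwards [hv] with r hr hmem
  exact hr (uIcc_subset_Icc ht hs (uIoc_subset_uIcc hmem))

theorem lintegral_control_norm_sq (hT : 0 ≤ T) (hu : ‖u‖ ≤ M) :
    ∫⁻ t in Icc t₀ (t₀ + T), ENNReal.ofReal (‖u t‖ ^ 2) =
      ENNReal.ofReal (∫ t in t₀..(t₀ + T), ‖u t‖ ^ 2) := by
  have hle : t₀ ≤ t₀ + T := by linarith
  have := intervalIntegrable_control_norm_sq hu (left_mem_Icc.2 hle) (right_mem_Icc.2 hle)
  rw [intervalIntegral.integral_of_le hle, ofReal_integral_eq_lintegral_ofReal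
    ((intervalIntegrable_iff_integrableOn_Ioc_of_le hle).1 this)
    (Eventually.of_forall fun t => sq_nonneg _),
    setLIntegral_congr (Ioc_ae_eq_Icc (μ := volume))]

end Primitive

variable {X Y : Type*} [NormedAddCommGroup X] [NormedSpace ℝ X]
  [NormedAddCommGroup Y] [NormedSpace ℝ Y]

section Compactness

variable [FiniteDimensional ℝ Y]

/-- First order expansion of a response, with a remainder that is uniform in the control. -/
theorem IsResponse.norm_sub_le_sq {S : ControlSystem X Y} {T t₀ R M : ℝ} {x₀ : X} {C K : ℝ≥0}
    {u : Control Y T t₀} {x : ℝ → X} (hT : 0 ≤ T)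
    (hC : ∀ x, ‖x‖ ≤ R → ∀ u, ‖u‖ ≤ M → ‖S.f x + S.g x u‖ ≤ C)
    (hK : ∀ x, ‖x‖ ≤ R → ∀ z, ‖z‖ ≤ R → ∀ u, ‖u‖ ≤ M →
      ‖(S.f x + S.g x u) - (S.f z + S.g z u)‖ ≤ K * ‖x - z‖)
    (hu : ‖u‖ ≤ M) (hx : S.IsResponse T t₀ x₀ u x) (hR : ∀ t ∈ Icc t₀ (t₀ + T), ‖x t‖ ≤ R)
    {s t : ℝ} (hs : s ∈ Icc t₀ (t₀ + T)) (ht : t ∈ Icc t₀ (t₀ + T)) :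
    ‖x s - x t - ((s - t) • S.f (x t) +
      S.g (x t) ((∫ r in t₀..s, u r) - ∫ r in t₀..t, u r))‖ ≤ K * C * |s - t| ^ 2 := by
  have : CompleteSpace Y := FiniteDimensional.complete ℝ Y
  have hle : t₀ ≤ t₀ + T := by linarith
  have ht₀ : t₀ ∈ Icc t₀ (t₀ + T) := left_mem_Icc.2 hle
  have hxl := hx.lipschitzOnWith hT hC hu hR
  have hUl : LipschitzOnWith M.toNNReal (fun t => ∫ r in t₀..t, u r) (Icc t₀ (t₀ + T)) :=
    lipschitzOnWith_primitive (fun s hs t ht => intervalIntegrable_control hu hs ht) (by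
      filter_upwards [ae_norm_le_of_control_norm_le hu] with r hr hmem
      exact (hr hmem).trans (Real.le_coe_toNNReal _))
  set U : ℝ → Y := fun t => ∫ r in t₀..t, u r with hU
  -- Subtracting the dynamics frozen at `x t` leaves a derivative that is a difference of the field
  -- at `x r` and `x t` for the same control value, hence at most `K * C * |s - t|`.
  set P : ℝ → X := fun r => x r - (r • S.f (x t) + S.g (x t) (U r)) with hP
  have hPac : AbsolutelyContinuousOnInterval P t₀ (t₀ + T) := by
    have h1 : AbsolutelyContinuousOnInterval (fun r : ℝ => r • S.f (x t)) t₀ (t₀ + T) :=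
      ContDiffOn.absolutelyContinuousOnInterval (by fun_prop)
    have h2 : AbsolutelyContinuousOnInterval (S.g (x t) ∘ U) t₀ (t₀ + T) :=
      absolutelyContinuousOnInterval_lipschitzOnWith_comp
        ((S.g (x t)).lipschitz.lipschitzOnWith (s := univ))
        (LipschitzOnWith.absolutelyContinuousOnInterval (by rwa [uIcc_of_le hle]))
        (mapsTo_univ _ _)
    exact hx.absolutelyContinuous.sub (h1.add h2)
  have hPd : ∀ᵐ r, r ∈ uIcc s t → ∃ v, HasDerivAt P v r ∧ ‖v‖ ≤ K * (C * |s - t|) := by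
    filter_upwards [hx.ae_imp_hasDerivAt, ae_norm_le_of_control_norm_le hu,
      (intervalIntegrable_control hu ht₀ (right_mem_Icc.2 hle)).ae_hasDerivAt_integral]
      with r h1 h2 h3 hr
    have hrI : r ∈ Icc t₀ (t₀ + T) := uIcc_subset_Icc hs ht hr
    rw [uIcc_of_le hle] at h3
    have hd : HasDerivAt P ((S.f (x r) + S.g (x r) (u r)) -
        ((1 : ℝ) • S.f (x t) + S.g (x t) (u r))) r :=
      (h1 hrI).sub (((hasDerivAt_id r).smul_const _).add
        ((S.g (x t)).hasFDerivAt.comp_hasDerivAt r (h3 hrI t₀ ht₀)))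
    refine ⟨_, hd, ?_⟩
    rw [one_smul]
    refine (hK _ (hR r hrI) _ (hR t ht) _ (h2 hrI)).trans ?_
    gcongr
    have h4 := hxl.dist_le_mul r hrI t ht
    rw [dist_eq_norm, Real.dist_eq] at h4
    refine h4.trans (mul_le_mul_of_nonneg_left ?_ C.2)
    rw [abs_sub_comm s t, abs_sub_comm r t]
    exact abs_sub_right_of_mem_uIcc hr
  have hfin : ‖P s - P t‖ ≤ K * (C * |s - t|) * |s - t| := by
    have hmono : uIcc s t ⊆ uIcc t₀ (t₀ + T) := by
      rw [uIcc_of_le hle]; exact uIcc_subset_Icc hs ht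
    rcases le_total s t with hst | hst
    · rw [norm_sub_rev]
      rw [uIcc_of_le hst] at hPd
      have := norm_sub_le_of_ae_hasDerivAt hst (hPac.mono hmono) hPd
      rwa [← abs_of_nonneg (sub_nonneg.2 hst), abs_sub_comm t s] at this
    · rw [uIcc_of_ge hst] at hPd
      rw [uIcc_comm] at hmono
      have := norm_sub_le_of_ae_hasDerivAt hst (hPac.mono hmono) hPd
      rw [abs_of_nonneg (sub_nonneg.2 hst)] at this ⊢
      exact this
  have heq : x s - x t - ((s - t) • S.f (x t) + S.g (x t) (U s - U t)) = P s - P t := by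
    simp only [hP, map_sub, sub_smul]
    abel
  rw [heq]
  calc _ ≤ _ := hfin
    _ = _ := by ring

/-- Sequential compactness of the set of bounded responses, and lower semicontinuity of the control
energy. -/
theorem exists_subseq_tendsto_response [FiniteDimensional ℝ X] (S : ControlSystem X Y) {T t₀ R M : ℝ} {x₀ : X}
    (hT : 0 ≤ T) {u : ℕ → Control Y T t₀} {x : ℕ → ℝ → X} (hu : ∀ k, ‖u k‖ ≤ M)
    (hx : ∀ k, S.IsResponse T t₀ x₀ (u k) (x k))
    (hR : ∀ k, ∀ t ∈ Icc t₀ (t₀ + T), ‖x k t‖ ≤ R) :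
    ∃ σ : ℕ → ℕ, StrictMono σ ∧ ∃ (v : Control Y T t₀) (z : ℝ → X), ‖v‖ ≤ M ∧
      S.IsResponse T t₀ x₀ v z ∧
      (∀ t ∈ Icc t₀ (t₀ + T), Tendsto (fun k => x (σ k) t) atTop (𝓝 (z t))) ∧
      ∃ c, Tendsto (fun k => ∫⁻ t in Icc t₀ (t₀ + T), ENNReal.ofReal (‖u (σ k) t‖ ^ 2)) atTop
          (𝓝 c) ∧
        ∫⁻ t in Icc t₀ (t₀ + T), ENNReal.ofReal (‖v t‖ ^ 2) ≤ c := by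
  have : CompleteSpace Y := FiniteDimensional.complete ℝ Y
  have : ProperSpace (X × Y × ℝ) := FiniteDimensional.proper_real _
  have hM : 0 ≤ M := (norm_nonneg _).trans (hu 0)
  have hle : t₀ ≤ t₀ + T := by linarith
  have ht₀ : t₀ ∈ Icc t₀ (t₀ + T) := left_mem_Icc.2 hle
  obtain ⟨C, hC⟩ := S.exists_field_bound R M
  obtain ⟨K, hK⟩ := S.exists_field_lipschitz R M
  set U : ℕ → ℝ → Y := fun k t => ∫ r in t₀..t, u k r with hU
  set c : ℕ → ℝ → ℝ := fun k t => ∫ r in t₀..t, ‖u k r‖ ^ 2 with hc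
  have hxl : ∀ k, LipschitzOnWith C (x k) (Icc t₀ (t₀ + T)) := fun k =>
    (hx k).lipschitzOnWith hT hC (hu k) (hR k)
  have hUl : ∀ k, LipschitzOnWith M.toNNReal (U k) (Icc t₀ (t₀ + T)) := fun k =>
    lipschitzOnWith_primitive (fun s hs t ht => intervalIntegrable_control (hu k) hs ht) (by
      filter_upwards [ae_norm_le_of_control_norm_le (hu k)] with r hr hmem
      exact (hr hmem).trans (Real.le_coe_toNNReal _))
  have hcl : ∀ k, LipschitzOnWith (M ^ 2).toNNReal (c k) (Icc t₀ (t₀ + T)) := fun k =>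
    lipschitzOnWith_primitive (fun s hs t ht => intervalIntegrable_control_norm_sq (hu k) hs ht) (by
      filter_upwards [ae_norm_le_of_control_norm_le (hu k)] with r hr hmem
      refine le_trans ?_ (Real.le_coe_toNNReal _)
      have := hr hmem
      rw [norm_pow, norm_norm]
      gcongr)
  obtain ⟨σ, hσ, W, hW, hlim⟩ := exists_subseq_tendsto_of_lipschitzOnWith hle
    (Z := fun k t => (x k t, U k t, c k t))
    (R := max R (max (M.toNNReal * T) ((M ^ 2).toNNReal * T)))
    (fun k => (hxl k).prodMk ((hUl k).prodMk (hcl k)))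
    (fun k t ht => by
      refine max_le_max (hR k t ht) (max_le_max ?_ ?_)
      · exact norm_le_mul_of_lipschitzOnWith (hUl k) (by simp [hU]) ht
      · exact norm_le_mul_of_lipschitzOnWith (hcl k) (by simp [hc]) ht)
  set z : ℝ → X := fun t => (W t).1 with hz
  set V : ℝ → Y := fun t => (W t).2.1 with hV
  set e : ℝ → ℝ := fun t => (W t).2.2 with he
  have hzlim : ∀ t ∈ Icc t₀ (t₀ + T), Tendsto (fun k => x (σ k) t) atTop (𝓝 (z t)) :=
    fun t ht => (hlim t ht).fst_nhds
  have hVlim : ∀ t ∈ Icc t₀ (t₀ + T), Tendsto (fun k => U (σ k) t) atTop (𝓝 (V t)) :=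
    fun t ht => (hlim t ht).snd_nhds.fst_nhds
  have helim : ∀ t ∈ Icc t₀ (t₀ + T), Tendsto (fun k => c (σ k) t) atTop (𝓝 (e t)) :=
    fun t ht => (hlim t ht).snd_nhds.snd_nhds
  have hzl := LipschitzWith.prod_fst.comp hW
  have hVl := LipschitzWith.prod_fst.comp (LipschitzWith.prod_snd.comp hW)
  have hel := LipschitzWith.prod_snd.comp (LipschitzWith.prod_snd.comp hW)
  -- Convergence is known only on the closed interval, so derivatives of the limit are examined at
  -- interior points.
  have hIoo : ∀ᵐ t, t ∈ Icc t₀ (t₀ + T) → t ∈ Ioo t₀ (t₀ + T) := by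
    have h1 := (Ioo_ae_eq_Icc (a := t₀) (b := t₀ + T) (μ := volume)).mem_iff
    filter_upwards [h1] with t ht using ht.2
  have hVd : ∀ᵐ t, t ∈ Icc t₀ (t₀ + T) → HasDerivAt V (deriv V t) t ∧ ‖deriv V t‖ ≤ M := by
    filter_upwards [hIoo, hVl.ae_differentiableAt_real] with t h1 h2 ht
    have h3 : HasDerivAt V (deriv V t) t := h2.hasDerivAt
    refine ⟨h3, h3.le_of_lip' hM ?_⟩
    filter_upwards [Icc_mem_nhds (h1 ht).1 (h1 ht).2] with s hs
    refine le_of_tendsto ((hVlim s hs).sub (hVlim t ht)).norm (Eventually.of_forall fun k => ?_)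
    have := (hUl (σ k)).dist_le_mul s hs t ht
    rwa [dist_eq_norm, dist_eq_norm, Real.coe_toNNReal _ hM] at this
  have hVM : ∀ᵐ t ∂(volume.restrict (Icc t₀ (t₀ + T))), ‖deriv V t‖ ≤ M := by
    rw [ae_restrict_iff' measurableSet_Icc]
    filter_upwards [hVd] with t h1 ht using (h1 ht).2
  have hmem : MemLp (deriv V) ∞ (volume.restrict (Icc t₀ (t₀ + T))) :=
    memLp_top_of_bound (stronglyMeasurable_deriv V).aestronglyMeasurable M hVM
  set v : Control Y T t₀ := hmem.toLp with hv
  have hvV : ∀ᵐ t ∂(volume.restrict (Icc t₀ (t₀ + T))), v t = deriv V t := hmem.coeFn_toLp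
  refine ⟨σ, hσ, v, z, ?_, ⟨?_, ?_, ?_⟩, hzlim, ENNReal.ofReal (e (t₀ + T)), ?_, ?_⟩
  · have := Lp.norm_le_of_ae_bound (f := v) hM (by
      filter_upwards [hvV, hVM] with t h1 h2
      rwa [h1])
    simpa using this
  · exact LipschitzOnWith.absolutelyContinuousOnInterval hzl.lipschitzOnWith
  · refine tendsto_nhds_unique (hzlim t₀ ht₀) ?_
    simp only [(hx _).initial]
    exact tendsto_const_nhds
  · rw [ae_restrict_iff' measurableSet_Icc] at hvV ⊢
    filter_upwards [hvV, hVd, hIoo] with t h1 h2 h3 ht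
    rw [h1 ht]
    -- The expansion has a remainder constant independent of `k`; for fixed `s` and `t` every term
    -- converges.
    refine hasDerivAt_of_norm_sub_le_sq (D := K * C) ?_ (h2 ht).1
    filter_upwards [Icc_mem_nhds (h3 ht).1 (h3 ht).2] with s hs
    have hf : Tendsto (fun k => S.f (x (σ k) t)) atTop (𝓝 (S.f (z t))) :=
      (S.contDiff_f.continuous.tendsto (z t)).comp (hzlim t ht)
    have hg : Tendsto (fun k => S.g (x (σ k) t)) atTop (𝓝 (S.g (z t))) :=
      (S.contDiff_g.continuous.tendsto (z t)).comp (hzlim t ht)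
    have hgV : Tendsto (fun k => S.g (x (σ k) t) (U (σ k) s - U (σ k) t)) atTop
        (𝓝 (S.g (z t) (V s - V t))) :=
      (isBoundedBilinearMap_apply.continuous.tendsto (S.g (z t), V s - V t)).comp
        (hg.prodMk_nhds ((hVlim s hs).sub (hVlim t ht)))
    refine le_of_tendsto ((((hzlim s hs).sub (hzlim t ht)).sub ((hf.const_smul (s - t)).add
      hgV)).norm) (Eventually.of_forall fun k => ?_)
    exact (hx (σ k)).norm_sub_le_sq hT hC hK (hu _) (hR _) hs ht
  · simp_rw [lintegral_control_norm_sq hT (hu _)]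
    exact (ENNReal.continuous_ofReal.tendsto _).comp (helim _ (right_mem_Icc.2 hle))
  · have he0 : e t₀ = 0 := by
      refine tendsto_nhds_unique (helim t₀ ht₀) ?_
      simp [hc]
    have h1 : ∫⁻ t in Icc t₀ (t₀ + T), ENNReal.ofReal (‖v t‖ ^ 2)
        = ∫⁻ t in Icc t₀ (t₀ + T), ENNReal.ofReal (‖deriv V t‖ ^ 2) := by
      refine lintegral_congr_ae ?_
      filter_upwards [hvV] with t ht
      rw [ht]
    rw [h1, ← sub_zero (e (t₀ + T)), ← he0]
    refine lintegral_norm_deriv_sq_le hle hVl hel fun s hs t ht hst => ?_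
    refine le_of_tendsto_of_tendsto' (((hVlim t ht).sub (hVlim s hs)).norm.pow 2)
      (((helim t ht).sub (helim s hs)).const_mul (t - s)) fun k => ?_
    simp only [hU, hc]
    rw [intervalIntegral.integral_interval_sub_left (intervalIntegrable_control (hu _) ht₀ ht)
      (intervalIntegrable_control (hu _) ht₀ hs), intervalIntegral.integral_interval_sub_left
      (intervalIntegrable_control_norm_sq (hu _) ht₀ ht)
      (intervalIntegrable_control_norm_sq (hu _) ht₀ hs)]
    refine norm_integral_sq_le hst (Lp.stronglyMeasurable _).aestronglyMeasurable (M := M) ?_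
    filter_upwards [ae_norm_le_of_control_norm_le (hu (σ k))] with r hr hmem
    exact hr ⟨hs.1.trans hmem.1.le, hmem.2.trans ht.2⟩

end Compactness

end ControlSystem

/-! ### Non-integrability of the barrier at the funnel boundary -/

section Barrier

/-- The penalty for a normalized tracking error `w`. -/
noncomputable def barrier (w : ℝ) : ℝ≥0∞ := ENNReal.ofReal (1 / (1 - w ^ 2) - 1)

/-- Restricted to errors below `1`: for `w ≥ 1` the real expression is negative and `ENNReal.ofReal`
truncates it to `0`. -/
theorem continuousAt_barrier {w : ℝ} (h0 : 0 ≤ w) (h1 : w < 1) : ContinuousAt barrier w := by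
  have : 1 - w ^ 2 ≠ 0 := by nlinarith
  refine ENNReal.continuous_ofReal.continuousAt.comp (f := fun w : ℝ => 1 / (1 - w ^ 2) - 1) ?_
  fun_prop (disch := assumption)

theorem one_div_one_sub_sq_sub_one_nonneg {w : ℝ} (h0 : 0 ≤ w) (h1 : w < 1) :
    0 ≤ 1 / (1 - w ^ 2) - 1 := by
  have h2 : 0 < 1 - w ^ 2 := by nlinarith
  rw [sub_nonneg, le_div_iff₀ h2]
  nlinarith

/-- The barrier is not integrable along a Lipschitz function that reaches `1`. -/
theorem exists_lintegral_barrier_eq_top {w : ℝ → ℝ} {a b : ℝ} {K : ℝ≥0}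
    (hw : LipschitzOnWith K w (Icc a b)) (h0 : ∀ t ∈ Icc a b, 0 ≤ w t) (ha : w a < 1)
    (hex : ∃ t ∈ Icc a b, 1 ≤ w t) :
    ∃ c ∈ Icc a b, (∀ t ∈ Ico a c, w t < 1) ∧ ∫⁻ t in Ico a c, barrier (w t) = ⊤ := by
  set A : Set ℝ := Icc a b ∩ w ⁻¹' Ici 1 with hA
  have hAc : IsCompact A := isCompact_Icc.of_isClosed_subset
    (hw.continuousOn.preimage_isClosed_of_isClosed isClosed_Icc isClosed_Ici) inter_subset_left
  have hcA : sInf A ∈ A := hAc.sInf_mem hex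
  set c := sInf A with hc
  have hlt : ∀ t ∈ Ico a c, w t < 1 := by
    intro t ht
    by_contra! hge
    exact (csInf_le hAc.bddBelow ⟨⟨ht.1, ht.2.le.trans hcA.1.2⟩, hge⟩).not_gt ht.2
  have hac : a < c := by
    refine lt_of_le_of_ne hcA.1.1 fun h => ?_
    have : 1 ≤ w c := hcA.2
    rw [← h] at this
    linarith
  have hsub : Ico a c ⊆ Icc a b := fun t ht => ⟨ht.1, ht.2.le.trans hcA.1.2⟩
  refine ⟨c, hcA.1, hlt, ?_⟩
  by_contra hfin
  have hcont : ContinuousOn (fun t => 1 / (1 - w t ^ 2) - 1) (Ico a c) := by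
    refine (continuousOn_const.div (continuousOn_const.sub ((hw.continuousOn.mono hsub).pow 2))
      fun t ht => ?_).sub continuousOn_const
    have h1 := hlt t ht
    have h2 := h0 t (hsub ht)
    have h3 : 0 < 1 - w t ^ 2 := by nlinarith
    exact h3.ne'
  have hint : IntegrableOn (fun t => 1 / (1 - w t ^ 2) - 1) (Ico a c) := by
    refine ⟨hcont.aestronglyMeasurable measurableSet_Ico, ?_⟩
    rw [hasFiniteIntegral_iff_ofReal]
    · exact lt_top_iff_ne_top.2 hfin
    · rw [EventuallyLE, ae_restrict_iff' measurableSet_Ico]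
      exact Eventually.of_forall fun t ht =>
        one_div_one_sub_sq_sub_one_nonneg (h0 t (hsub ht)) (hlt t ht)
  have hint' : IntegrableOn (fun t => 2 * (K : ℝ) * ((1 / (1 - w t ^ 2) - 1) + 1)) (Ico a c) :=
    (hint.add (integrableOn_const (by simp))).const_mul _
  -- From `w c ≥ 1` and `1 - w² = (1 + w)(1 - w) ≤ 2K(c - t)`, integrability of the barrier would
  -- make `1/(t - c)` integrable up to its pole.
  have hinv : IntegrableOn (fun t => (t - c)⁻¹) (Ico a c) := by
    refine Integrable.mono' hint' (by fun_prop) ?_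
    rw [ae_restrict_iff' measurableSet_Ico]
    refine Eventually.of_forall fun t ht => ?_
    have hw0 := h0 t (hsub ht)
    have hw1 := hlt t ht
    have hpos : 0 < c - t := sub_pos.2 ht.2
    have hsq : 0 < 1 - w t ^ 2 := by nlinarith
    have hl := hw.dist_le_mul c hcA.1 t (hsub ht)
    rw [Real.dist_eq, Real.dist_eq, abs_of_pos hpos] at hl
    have h1 : 1 - w t ≤ K * (c - t) :=
      (sub_le_sub_right hcA.2 _).trans ((le_abs_self _).trans hl)
    have h2 : 1 - w t ^ 2 ≤ 2 * K * (c - t) := by nlinarith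
    rw [norm_inv, Real.norm_eq_abs, abs_sub_comm, abs_of_pos hpos, sub_add_cancel, mul_one_div,
      inv_eq_one_div, div_le_div_iff₀ hpos hsq]
    linarith
  have hii : IntervalIntegrable (fun t => (t - c)⁻¹) volume a c := by
    rw [intervalIntegrable_iff_integrableOn_Ioc_of_le hac.le]
    exact hinv.congr_set_ae Ico_ae_eq_Ioc.symm
  rcases intervalIntegrable_sub_inv_iff.1 hii with h | h
  · exact hac.ne h
  · exact h right_mem_uIcc

end Barrier

/-! ### The cost functional and its lower semicontinuity -/

namespace ControlSystem

variable {X Y : Type*} [NormedAddCommGroup X] [NormedSpace ℝ X]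
  [NormedAddCommGroup Y] [NormedSpace ℝ Y]

/-- The normalized tracking error along a trajectory. -/
noncomputable def trackingError (S : ControlSystem X Y) (φ : ℝ → ℝ) (yref : ℝ → Y) (x : ℝ → X)
    (t : ℝ) : ℝ :=
  φ t * ‖S.h (x t) - yref t‖

section

variable {S : ControlSystem X Y} {φ : ℝ → ℝ} {yref : ℝ → Y} {T t₀ M lam : ℝ} {x₀ : X}

theorem trackingError_nonneg (hφ : φ ∈ funnelFunctions) (x : ℝ → X) {t : ℝ} (ht : 0 ≤ t) :
    0 ≤ S.trackingError φ yref x t := by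
  obtain ⟨δ, hδ, h⟩ := exists_pos_le_of_mem_funnelFunctions hφ
  exact mul_nonneg (hδ.le.trans (h t ht)) (norm_nonneg _)

theorem exists_lipschitzOnWith_trackingError [FiniteDimensional ℝ X] [FiniteDimensional ℝ Y]
    (hφ : φ ∈ funnelFunctions) (hyref : MemW1Infty yref) (ht₀ : 0 ≤ t₀) {x : ℝ → X} {C : ℝ≥0}
    (hx : LipschitzOnWith C x (Icc t₀ (t₀ + T))) :
    ∃ K, LipschitzOnWith K (S.trackingError φ yref x) (Icc t₀ (t₀ + T)) := by
  have : CompleteSpace Y := FiniteDimensional.complete ℝ Y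
  have hIcc : Icc t₀ (t₀ + T) ⊆ Ici 0 := fun t ht => ht₀.trans ht.1
  obtain ⟨K₁, hK₁⟩ := hφ.1.exists_lipschitzOnWith
  obtain ⟨K₂, hK₂⟩ := hyref.exists_lipschitzOnWith
  replace hK₁ := hK₁.mono hIcc
  replace hK₂ := hK₂.mono hIcc
  obtain ⟨R, hR⟩ := isCompact_Icc.exists_bound_of_continuousOn hx.continuousOn
  have hh : ContDiff ℝ 1 S.h := S.contDiff_h.of_le one_le_two
  obtain ⟨K₃, hK₃⟩ := hh.contDiffOn.exists_lipschitzOnWith one_ne_zero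
    (convex_closedBall (0 : X) R) (isCompact_closedBall (0 : X) R)
  have hN : LipschitzOnWith (K₃ * C + K₂) (fun t => S.h (x t) - yref t) (Icc t₀ (t₀ + T)) :=
    (hK₃.comp hx fun t ht => mem_closedBall_zero_iff.2 (hR t ht)).sub hK₂
  obtain ⟨A, hA⟩ := isCompact_Icc.exists_bound_of_continuousOn hK₁.continuousOn
  obtain ⟨B, hB⟩ := isCompact_Icc.exists_bound_of_continuousOn hN.continuousOn
  refine ⟨A.toNNReal * (K₃ * C + K₂) + B.toNNReal * K₁,
    LipschitzOnWith.of_dist_le_mul fun s hs t ht => ?_⟩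
  have h1 := hK₁.dist_le_mul s hs t ht
  have h2 := hN.dist_le_mul s hs t ht
  rw [Real.dist_eq] at h1
  have h3 : |φ s| ≤ A.toNNReal := (hA s hs).trans (Real.le_coe_toNNReal _)
  have h4 : ‖S.h (x t) - yref t‖ ≤ B.toNNReal := (hB t ht).trans (Real.le_coe_toNNReal _)
  have h5 : |‖S.h (x s) - yref s‖ - ‖S.h (x t) - yref t‖| ≤
      (K₃ * C + K₂ : ℝ≥0) * dist s t := by
    refine (abs_norm_sub_norm_le _ _).trans ?_
    rwa [dist_eq_norm] at h2
  rw [Real.dist_eq]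
  simp only [trackingError]
  calc |φ s * ‖S.h (x s) - yref s‖ - φ t * ‖S.h (x t) - yref t‖|
      = |φ s * (‖S.h (x s) - yref s‖ - ‖S.h (x t) - yref t‖) +
          ‖S.h (x t) - yref t‖ * (φ s - φ t)| := by ring_nf
    _ ≤ |φ s| * |‖S.h (x s) - yref s‖ - ‖S.h (x t) - yref t‖| +
          ‖S.h (x t) - yref t‖ * |φ s - φ t| := by
        refine (abs_add_le _ _).trans_eq ?_
        rw [abs_mul, abs_mul, abs_norm]
    _ ≤ A.toNNReal * ((K₃ * C + K₂ : ℝ≥0) * dist s t) + B.toNNReal * (K₁ * dist s t) := by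
        gcongr
    _ = _ := by push_cast; ring

theorem stageCost_eq (x : ℝ → X) (u : Y) {t : ℝ} (h : S.trackingError φ yref x t < 1) :
    S.stageCost φ yref lam t (x t) u =
      ((1 / (1 - S.trackingError φ yref x t ^ 2) - 1 + lam * ‖u‖ ^ 2 : ℝ) : EReal) := by
  rw [trackingError] at h
  rw [stageCost, if_pos h.ne, trackingError, mul_pow]

theorem exists_lintegral_barrier_response_eq_top [FiniteDimensional ℝ X] [FiniteDimensional ℝ Y]
    (hφ : φ ∈ funnelFunctions) (hyref : MemW1Infty yref) (hT : 0 ≤ T) (ht₀ : 0 ≤ t₀)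
    (hx₀ : x₀ ∈ S.funnelStates φ yref t₀) {u : Control Y T t₀} {x : ℝ → X}
    (hx : S.IsResponse T t₀ x₀ u x)
    (hex : ¬ ∀ t ∈ Icc t₀ (t₀ + T), x t ∈ S.funnelStates φ yref t) :
    ∃ c ∈ Icc t₀ (t₀ + T), (∀ t ∈ Ico t₀ c, S.trackingError φ yref x t < 1) ∧
      ∫⁻ t in Ico t₀ c, barrier (S.trackingError φ yref x t) = ⊤ := by
  obtain ⟨R, hR⟩ := hx.exists_bound hT
  obtain ⟨C, hC⟩ := S.exists_field_bound R ‖u‖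
  obtain ⟨K, hK⟩ := exists_lipschitzOnWith_trackingError (S := S) hφ hyref ht₀
    (hx.lipschitzOnWith hT hC le_rfl hR)
  refine exists_lintegral_barrier_eq_top hK
    (fun t ht => trackingError_nonneg hφ x (ht₀.trans ht.1)) ?_ ?_
  · rw [trackingError, hx.initial]
    exact hx₀
  · push Not at hex
    obtain ⟨t, ht, h⟩ := hex
    exact ⟨t, ht, not_lt.1 h⟩

/-- If the response exists, it must leave the funnel, and the barrier before the first exit already
makes the positive part infinite. Later contributions can be negative, but quasi-integrability keeps
their integral finite and so excludes `⊤ - ⊤`. -/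
theorem cost_eq_top [FiniteDimensional ℝ X] [FiniteDimensional ℝ Y]
    (hφ : φ ∈ funnelFunctions) (hyref : MemW1Infty yref) (hlam : 0 ≤ lam) (hT : 0 ≤ T)
    (ht₀ : 0 ≤ t₀) (hx₀ : x₀ ∈ S.funnelStates φ yref t₀) {u : Control Y T t₀} (hu : ‖u‖ ≤ M)
    (hnot : u ∉ S.admissibleControls φ yref T M t₀ x₀) :
    S.cost φ yref lam T t₀ x₀ u = ⊤ := by
  rw [cost]
  split_ifs with h
  swap
  · rfl
  obtain ⟨hfeas, hquasi⟩ := h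
  set x := S.response T t₀ x₀ u with hxdef
  obtain ⟨c, hc, hlt, htop⟩ := exists_lintegral_barrier_response_eq_top hφ hyref hT ht₀ hx₀
    (isResponse_response hfeas) fun hall => hnot ⟨hfeas, hall, hu⟩
  have hpos : ∫⁻ t in Icc t₀ (t₀ + T),
      (S.stageCostAlong φ yref lam T t₀ x₀ u t).toENNReal = ⊤ := by
    rw [eq_top_iff, ← htop]
    have hsub : Ico t₀ c ⊆ Icc t₀ (t₀ + T) := fun t ht => ⟨ht.1, ht.2.le.trans hc.2⟩
    refine le_trans (setLIntegral_mono' measurableSet_Ico fun t ht => ?_)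
      (lintegral_mono_set hsub)
    rw [stageCostAlong, stageCost_eq _ _ (hlt t ht), EReal.real_coe_toENNReal]
    exact ENNReal.ofReal_le_ofReal (le_add_of_nonneg_right (by positivity))
  have hneg : ∫⁻ t in Icc t₀ (t₀ + T),
      (-S.stageCostAlong φ yref lam T t₀ x₀ u t).toENNReal < ⊤ :=
    hquasi.2.resolve_left (by rw [hpos]; exact lt_irrefl _)
  rw [extendedIntegral, hpos, EReal.coe_ennreal_top]
  exact EReal.top_sub (by simpa using hneg.ne)

/-- The cost of a response that evolves in the funnel, as a number in `[0, ∞]`. -/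
noncomputable def funnelCost (S : ControlSystem X Y) (φ : ℝ → ℝ) (yref : ℝ → Y) (lam T t₀ : ℝ)
    (u : Control Y T t₀) (x : ℝ → X) : ℝ≥0∞ :=
  (∫⁻ t in Icc t₀ (t₀ + T), barrier (S.trackingError φ yref x t)) +
    ENNReal.ofReal lam * ∫⁻ t in Icc t₀ (t₀ + T), ENNReal.ofReal (‖u t‖ ^ 2)

theorem aemeasurable_one_div_trackingError (hφ : φ ∈ funnelFunctions) (hyref : MemW1Infty yref)
    (ht₀ : 0 ≤ t₀) {x : ℝ → X} (hx : ContinuousOn x (Icc t₀ (t₀ + T))) :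
    AEMeasurable (fun t => 1 / (1 - S.trackingError φ yref x t ^ 2) - 1)
      (volume.restrict (Icc t₀ (t₀ + T))) := by
  have hIcc : Icc t₀ (t₀ + T) ⊆ Ici 0 := fun t ht => ht₀.trans ht.1
  have h1 : ContinuousOn (S.trackingError φ yref x) (Icc t₀ (t₀ + T)) :=
    (hφ.1.continuousOn.mono hIcc).mul
      ((S.contDiff_h.continuous.comp_continuousOn hx).sub (hyref.continuousOn.mono hIcc)).norm
  have h2 := h1.aemeasurable (μ := volume) measurableSet_Icc
  fun_prop

/-- Inside the funnel the stage cost is nonnegative, so its negative part vanishes and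
quasi-integrability is automatic. -/
theorem cost_eq_funnelCost (hφ : φ ∈ funnelFunctions) (hyref : MemW1Infty yref) (hlam : 0 ≤ lam)
    (hT : 0 ≤ T) (ht₀ : 0 ≤ t₀) {u : Control Y T t₀}
    (hu : u ∈ S.admissibleControls φ yref T M t₀ x₀) :
    S.cost φ yref lam T t₀ x₀ u = S.funnelCost φ yref lam T t₀ u (S.response T t₀ x₀ u) := by
  set x := S.response T t₀ x₀ u with hxdef
  have hx : S.IsResponse T t₀ x₀ u x := isResponse_response hu.1
  have hm := aemeasurable_one_div_trackingError (S := S) hφ hyref ht₀ (hx.continuousOn hT)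
  have hum : Measurable fun t => ‖u t‖ ^ 2 := (Lp.stronglyMeasurable u).norm.measurable.pow_const 2
  have heq : ∀ t ∈ Icc t₀ (t₀ + T), S.stageCostAlong φ yref lam T t₀ x₀ u t =
      ((1 / (1 - S.trackingError φ yref x t ^ 2) - 1 + lam * ‖u t‖ ^ 2 : ℝ) : EReal) :=
    fun t ht => stageCost_eq x (u t) (hu.2.1 t ht)
  have hnn : ∀ t ∈ Icc t₀ (t₀ + T), 0 ≤ 1 / (1 - S.trackingError φ yref x t ^ 2) - 1 :=
    fun t ht => one_div_one_sub_sq_sub_one_nonneg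
      (trackingError_nonneg hφ x (ht₀.trans ht.1)) (hu.2.1 t ht)
  have hneg : ∫⁻ t in Icc t₀ (t₀ + T),
      (-S.stageCostAlong φ yref lam T t₀ x₀ u t).toENNReal = 0 := by
    rw [setLIntegral_congr_fun (g := fun _ => 0) measurableSet_Icc, lintegral_zero]
    intro t ht
    have h1 := hnn t ht
    have h2 : 0 ≤ lam * ‖u t‖ ^ 2 := by positivity
    simp only [heq t ht]
    rw [← EReal.coe_neg, EReal.real_coe_toENNReal]
    exact ENNReal.ofReal_of_nonpos (by linarith)
  have hpos : ∫⁻ t in Icc t₀ (t₀ + T), (S.stageCostAlong φ yref lam T t₀ x₀ u t).toENNReal =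
      S.funnelCost φ yref lam T t₀ u x := by
    rw [funnelCost, ← lintegral_const_mul _ hum.ennreal_ofReal,
      ← lintegral_add_right _ (hum.ennreal_ofReal.const_mul _)]
    refine setLIntegral_congr_fun measurableSet_Icc fun t ht => ?_
    simp only [heq t ht]
    rw [EReal.real_coe_toENNReal, ENNReal.ofReal_add (hnn t ht) (by positivity),
      ENNReal.ofReal_mul hlam, barrier]
  have hquasi : QuasiIntegrable (S.stageCostAlong φ yref lam T t₀ x₀ u)
      (volume.restrict (Icc t₀ (t₀ + T))) := by
    refine ⟨?_, Or.inr (by rw [hneg]; exact ENNReal.zero_lt_top)⟩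
    refine (measurable_coe_real_ereal.comp_aemeasurable
      (hm.add (hum.aemeasurable.const_mul lam))).congr ?_
    rw [EventuallyEq, ae_restrict_iff' measurableSet_Icc]
    exact Eventually.of_forall fun t ht => (heq t ht).symm
  rw [cost, if_pos ⟨hu.1, hquasi⟩, extendedIntegral, hneg, hpos]
  simp

/-- Lower semicontinuity of the barrier term along pointwise convergent trajectories. -/
theorem setLIntegral_barrier_le_liminf (hφ : φ ∈ funnelFunctions) (hyref : MemW1Infty yref)
    (ht₀ : 0 ≤ t₀) {x : ℕ → ℝ → X} {z : ℝ → X}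
    (hx : ∀ k, ContinuousOn (x k) (Icc t₀ (t₀ + T)))
    (hlim : ∀ t ∈ Icc t₀ (t₀ + T), Tendsto (fun k => x k t) atTop (𝓝 (z t))) {A : Set ℝ}
    (hAm : MeasurableSet A) (hA : A ⊆ Icc t₀ (t₀ + T))
    (hz : ∀ t ∈ A, S.trackingError φ yref z t < 1) :
    ∫⁻ t in A, barrier (S.trackingError φ yref z t) ≤
      liminf (fun k => ∫⁻ t in Icc t₀ (t₀ + T), barrier (S.trackingError φ yref (x k) t)) atTop := by
  calc ∫⁻ t in A, barrier (S.trackingError φ yref z t)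
      = ∫⁻ t in A, liminf (fun k => barrier (S.trackingError φ yref (x k) t)) atTop := by
        refine setLIntegral_congr_fun hAm fun t ht => ?_
        have h1 : Tendsto (fun k => S.trackingError φ yref (x k) t) atTop
            (𝓝 (S.trackingError φ yref z t)) :=
          ((((S.contDiff_h.continuous.tendsto _).comp (hlim t (hA ht))).sub_const _).norm).const_mul _
        have h2 := (continuousAt_barrier (trackingError_nonneg hφ z (ht₀.trans (hA ht).1))
          (hz t ht)).tendsto.comp h1
        exact h2.liminf_eq.symm
    _ ≤ liminf (fun k => ∫⁻ t in A, barrier (S.trackingError φ yref (x k) t)) atTop := by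
        refine lintegral_liminf_le' fun k => ?_
        exact ((aemeasurable_one_div_trackingError hφ hyref ht₀ (hx k)).mono_measure
          (Measure.restrict_mono hA le_rfl)).ennreal_ofReal
    _ ≤ _ := liminf_le_liminf (Eventually.of_forall fun k => lintegral_mono_set hA)

/-- A minimizing sequence of admissible controls yields an admissible minimizer. -/
theorem exists_funnelCost_le [FiniteDimensional ℝ X] [FiniteDimensional ℝ Y]
    (hS : S.InSystemClass) (hφ : φ ∈ funnelFunctions) (hyref : MemW1Infty yref)
    (hT : 0 ≤ T) (ht₀ : 0 ≤ t₀) (hx₀ : x₀ ∈ S.funnelStates φ yref t₀) {m : ℝ≥0∞} (hm : m ≠ ⊤)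
    {u : ℕ → Control Y T t₀} (hu : ∀ k, u k ∈ S.admissibleControls φ yref T M t₀ x₀)
    (hlim : Tendsto (fun k => S.funnelCost φ yref lam T t₀ (u k) (S.response T t₀ x₀ (u k))) atTop
      (𝓝 m)) :
    ∃ v ∈ S.admissibleControls φ yref T M t₀ x₀,
      S.funnelCost φ yref lam T t₀ v (S.response T t₀ x₀ v) ≤ m := by
  obtain ⟨R, hR⟩ := S.exists_response_bound hS hφ hyref hT ht₀ x₀
  have hresp : ∀ k, S.IsResponse T t₀ x₀ (u k) (S.response T t₀ x₀ (u k)) := fun k =>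
    isResponse_response (hu k).1
  obtain ⟨σ, hσ, v, z, hvM, hz, hzlim, c, hc, hvc⟩ := S.exists_subseq_tendsto_response hT
    (fun k => (hu k).2.2) hresp (fun k => hR (u k) _ (hresp k) (hu k).2.1)
  set a : ℕ → ℝ≥0∞ := fun k => ∫⁻ t in Icc t₀ (t₀ + T),
    barrier (S.trackingError φ yref (S.response T t₀ x₀ (u (σ k))) t) with ha
  set b : ℕ → ℝ≥0∞ := fun k => ENNReal.ofReal lam *
    ∫⁻ t in Icc t₀ (t₀ + T), ENNReal.ofReal (‖u (σ k) t‖ ^ 2) with hb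
  have hablim : Tendsto (fun k => a k + b k) atTop (𝓝 m) := hlim.comp hσ.tendsto_atTop
  have hblim : Tendsto b atTop (𝓝 (ENNReal.ofReal lam * c)) :=
    ENNReal.Tendsto.const_mul hc (Or.inr ENNReal.ofReal_ne_top)
  have hbm : ENNReal.ofReal lam * c ≤ m :=
    le_of_tendsto_of_tendsto' hblim hablim fun k => le_add_self
  have hbfin : ∀ k, b k ≠ ⊤ := fun k => by
    simp only [hb, lintegral_control_norm_sq hT (hu (σ k)).2.2]
    exact ENNReal.mul_ne_top ENNReal.ofReal_ne_top ENNReal.ofReal_ne_top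
  -- The energies are finite and `m ≠ ⊤`, so the barrier part of the cost converges by subtraction
  -- in `ℝ≥0∞`.
  have halim : Tendsto a atTop (𝓝 (m - ENNReal.ofReal lam * c)) := by
    refine (ENNReal.Tendsto.sub hablim hblim (Or.inl hm)).congr fun k => ?_
    exact ENNReal.add_sub_cancel_right (hbfin k)
  have hfatou : ∀ A : Set ℝ, MeasurableSet A → A ⊆ Icc t₀ (t₀ + T) →
      (∀ t ∈ A, S.trackingError φ yref z t < 1) →
      ∫⁻ t in A, barrier (S.trackingError φ yref z t) ≤ m - ENNReal.ofReal lam * c := by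
    intro A hAm hA hlt
    rw [← halim.liminf_eq]
    exact setLIntegral_barrier_le_liminf hφ hyref ht₀ (fun k => (hresp (σ k)).continuousOn hT)
      hzlim hAm hA hlt
  -- Pointwise limits alone give only error at most `1`. Touching the boundary would make the
  -- barrier integral before the first contact infinite, against the Fatou bound.
  have hzfun : ∀ t ∈ Icc t₀ (t₀ + T), z t ∈ S.funnelStates φ yref t := by
    by_contra hnot
    obtain ⟨d, hd, hlt, htop⟩ := exists_lintegral_barrier_response_eq_top hφ hyref hT ht₀ hx₀ hz hnot
    have := hfatou _ measurableSet_Ico (fun t ht => ⟨ht.1, ht.2.le.trans hd.2⟩) hlt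
    rw [htop, top_le_iff] at this
    exact (ENNReal.sub_ne_top hm) this
  have hv : v ∈ S.feasibleControls T t₀ x₀ := ⟨z, hz⟩
  -- `response` is an arbitrary choice of solution; uniqueness identifies it with the limit `z`.
  have heq := (isResponse_response hv).eqOn hT hz
  refine ⟨v, ⟨hv, fun t ht => by rw [heq ht]; exact hzfun t ht, hvM⟩, ?_⟩
  have h1 : ∫⁻ t in Icc t₀ (t₀ + T),
      barrier (S.trackingError φ yref (S.response T t₀ x₀ v) t) ≤ m - ENNReal.ofReal lam * c := by
    rw [setLIntegral_congr_fun (g := fun t => barrier (S.trackingError φ yref z t))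
      measurableSet_Icc fun t ht => by simp only [trackingError, heq ht]]
    exact hfatou _ measurableSet_Icc Subset.rfl hzfun
  calc S.funnelCost φ yref lam T t₀ v (S.response T t₀ x₀ v)
      ≤ (m - ENNReal.ofReal lam * c) + ENNReal.ofReal lam * c := by
        rw [funnelCost]
        gcongr
    _ = m := tsub_add_cancel_of_le hbm

end

end ControlSystem

end FunnelMPC

/-! ### Existence of a minimizer and equality of the two minima -/

theorem mainTheorem2 {X Y : Type*}
    [NormedAddCommGroup X] [NormedSpace ℝ X] [FiniteDimensional ℝ X]
    [NormedAddCommGroup Y] [NormedSpace ℝ Y] [FiniteDimensional ℝ Y]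
    (S : FunnelMPC.ControlSystem X Y) (hS : S.InSystemClass)
    (φ : ℝ → ℝ) (hφ : φ ∈ FunnelMPC.funnelFunctions)
    (yref : ℝ → Y) (hyref : FunnelMPC.MemW1Infty yref)
    (lam : ℝ) (hlam : 0 ≤ lam) (T : ℝ) (hT : 0 < T) (M : ℝ) (hM : 0 < M)
    (t₀ : ℝ) (ht₀ : 0 ≤ t₀) (x₀ : X) (hx₀ : x₀ ∈ S.funnelStates φ yref t₀)
    (hne : (S.admissibleControls φ yref T M t₀ x₀).Nonempty) :
    ∃ ubar ∈ S.admissibleControls φ yref T M t₀ x₀,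
      IsLeast (S.cost φ yref lam T t₀ x₀ '' S.admissibleControls φ yref T M t₀ x₀)
        (S.cost φ yref lam T t₀ x₀ ubar) ∧
      IsLeast (S.cost φ yref lam T t₀ x₀ '' {u | ‖u‖ ≤ M})
        (S.cost φ yref lam T t₀ x₀ ubar) := by
  set J : FunnelMPC.ControlSystem.Control Y T t₀ → ℝ≥0∞ := fun u =>
    S.funnelCost φ yref lam T t₀ u (S.response T t₀ x₀ u) with hJ
  have hcost : ∀ u ∈ S.admissibleControls φ yref T M t₀ x₀,
      S.cost φ yref lam T t₀ x₀ u = J u := fun u hu =>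
    FunnelMPC.ControlSystem.cost_eq_funnelCost hφ hyref hlam hT.le ht₀ hu
  obtain ⟨ubar, hubar, hmin⟩ : ∃ ubar ∈ S.admissibleControls φ yref T M t₀ x₀,
      ∀ u ∈ S.admissibleControls φ yref T M t₀ x₀, J ubar ≤ J u := by
    have hle : ∀ u ∈ S.admissibleControls φ yref T M t₀ x₀,
        sInf (J '' S.admissibleControls φ yref T M t₀ x₀) ≤ J u := fun u hu =>
      sInf_le (mem_image_of_mem J hu)
    -- An infinite infimum makes every admissible control optimal; the compactness argument needs a
    -- finite one.
    by_cases hm : sInf (J '' S.admissibleControls φ yref T M t₀ x₀) = ⊤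
    · obtain ⟨u, hu⟩ := hne
      exact ⟨u, hu, fun w hw => le_top.trans (hm ▸ hle w hw)⟩
    · obtain ⟨s, -, hs, hsmem⟩ := exists_seq_tendsto_sInf (hne.image J) (OrderBot.bddBelow _)
      choose u hu hus using hsmem
      obtain ⟨v, hv, hvm⟩ := FunnelMPC.ControlSystem.exists_funnelCost_le (lam := lam) hS hφ hyref
        hT.le ht₀ hx₀ hm hu (hs.congr fun k => (hus k).symm)
      exact ⟨v, hv, fun w hw => hvm.trans (hle w hw)⟩
  have hadm : ∀ u ∈ S.admissibleControls φ yref T M t₀ x₀,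
      S.cost φ yref lam T t₀ x₀ ubar ≤ S.cost φ yref lam T t₀ x₀ u := by
    intro u hu
    rw [hcost u hu, hcost ubar hubar, EReal.coe_ennreal_le_coe_ennreal_iff]
    exact hmin u hu
  refine ⟨ubar, hubar, ⟨mem_image_of_mem _ hubar, ?_⟩, ⟨mem_image_of_mem _ hubar.2.2, ?_⟩⟩
  · rintro _ ⟨u, hu, rfl⟩
    exact hadm u hu
  · rintro _ ⟨u, hu, rfl⟩
    by_cases hmem : u ∈ S.admissibleControls φ yref T M t₀ x₀
    · exact hadm u hmem
    · rw [FunnelMPC.ControlSystem.cost_eq_top hφ hyref hlam hT.le ht₀ hx₀ hu hmem]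
      exact le_top
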